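/- Let $n\ge 1$. Let $H=H_n$ be the $(2n+1)$-dimensional Heisenberg group, the simply connected Lie group with Lie algebra spanned by $X_1,\dots,X_n,Y_1,\dots,Y_n,Z$ with nonzero brackets $[X_j,Y_j]=Z$, and let $S=S^1\ltimes H$ be the warped Heisenberg group, whose Lie algebra has one further generator $W$ (generating the factor $S^1$, with period $2\pi$) and the further brackets $[W,X_j]=Y_j$, $[W,Y_j]=-X_j$, $[W,Z]=0$. Let $\theta$ be the bi-invariant Lorentz metric on $S$ for which, at the identity, $X_1,\dots,Y_n$ are orthonormal, $Z$ and $W$ are isotropic and orthogonal to all $X_j,Y_j$, and $\langle W,Z\rangle=1$. Let $\Gamma$ be a cocompact lattice (a discrete subgroup with $S/\Gamma$ compact) of $S$ with $\Gamma\subseteq H$. Let $m:S^1=H\backslash S\to(0,\infty)$ be a smooth positive function that is not invariant under any nontrivial rotation of $S^1$ (for example, a positive bump function at $1$), and denote its pullback to $S$ again by $m$; then $m\theta$ descends to a Lorentz metric on the compact manifold $S/\Gamma$ (Adams' deformation). Then the identity component of the isometry group of $(S/\Gamma, m\theta)$, taken in the compact-open topology, is $H/\Lambda$ with $\Lambda=Z(H)\cap\Gamma$: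 the action of $H$ on $S/\Gamma$ by left translations is by isometries, it factors through $H/\Lambda$, and the resulting homomorphism $H/\Lambda\to\mathrm{Isom}(S/\Gamma,m\theta)$ is an isomorphism of topological groups onto $\mathrm{Isom}^0(S/\Gamma,m\theta)$. -/

import Mathlib

open scoped Manifold ContDiff Topology
noncomputable section

namespace WarpedHeisenberg

/-- The vector space `ℂⁿ × ℝ` underlying the Heisenberg group `Hₙ` in exponential coordinates:
`(v, c)` stands for `exp (∑ (Re vⱼ) Xⱼ + ∑ (Im vⱼ) Yⱼ + c Z)`. -/
abbrev HeisModel (n : ℕ) : Type := EuclideanSpace ℂ (Fin n) × ℝ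

/-- The warped Heisenberg group `S = S¹ ⋉ Hₙ` as a set: pairs of a point `z` of the circle and an
element `h = (v, c)` of the Heisenberg group; the pair stands for the product `h z`. The circle acts
on `Hₙ` by `z h z⁻¹ = (z v, c)`, so that `Ad (exp (t W)) Xⱼ = cos t Xⱼ + sin t Yⱼ`. -/
def Warped (n : ℕ) : Type := Circle × HeisModel n

/-- The model space of `S` as a manifold. -/
abbrev ModelHS (n : ℕ) : Type := ModelProd (EuclideanSpace ℝ (Fin 1)) (HeisModel n)

/-- The model vector space (of dimension `2n + 2`) of `S` as a manifold. -/
abbrev ModelVS (n : ℕ) : Type := EuclideanSpace ℝ (Fin 1) × HeisModel n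

/-- The model of `S` as a manifold: the product of the models of the circle and of `ℂⁿ × ℝ`. -/
abbrev modelS (n : ℕ) : ModelWithCorners ℝ (ModelVS n) (ModelHS n) :=
  (𝓡 1).prod 𝓘(ℝ, HeisModel n)

namespace Warped

variable {n : ℕ}

/-- The product topology and product manifold structure. -/
instance : TopologicalSpace (Warped n) := inferInstanceAs (TopologicalSpace (Circle × HeisModel n))
instance : ChartedSpace (ModelHS n) (Warped n) :=
  inferInstanceAs (ChartedSpace (ModelHS n) (Circle × HeisModel n))
instance : IsManifold (modelS n) ∞ (Warped n) :=
  inferInstanceAs (IsManifold ((𝓡 1).prod 𝓘(ℝ, HeisModel n)) ∞ (Circle × HeisModel n))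

/-- The element with circle component `z` and Heisenberg component `(v, c)`. -/
def mk (z : Circle) (v : EuclideanSpace ℂ (Fin n)) (c : ℝ) : Warped n :=
  ((z, (v, c)) : Circle × HeisModel n)
/-- The circle component; this is also the projection `S → H \ S = S¹`. -/
def rot (s : Warped n) : Circle := Prod.fst (α := Circle) (β := HeisModel n) s
/-- The `ℂⁿ` component. -/
def vec (s : Warped n) : EuclideanSpace ℂ (Fin n) :=
  (Prod.snd (α := Circle) (β := HeisModel n) s).1
/-- The central component. -/
def ht (s : Warped n) : ℝ := (Prod.snd (α := Circle) (β := HeisModel n) s).2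

@[ext] lemma ext {s t : Warped n} (h₁ : s.rot = t.rot) (h₂ : s.vec = t.vec) (h₃ : s.ht = t.ht) :
    s = t := Prod.ext h₁ (Prod.ext h₂ h₃)

@[simp] lemma rot_mk (z : Circle) (v : EuclideanSpace ℂ (Fin n)) (c : ℝ) : (mk z v c).rot = z := rfl
@[simp] lemma vec_mk (z : Circle) (v : EuclideanSpace ℂ (Fin n)) (c : ℝ) : (mk z v c).vec = v := rfl
@[simp] lemma ht_mk (z : Circle) (v : EuclideanSpace ℂ (Fin n)) (c : ℝ) : (mk z v c).ht = c := rfl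

/-- The product `(h z) (h' z') = (h (z h' z⁻¹)) (z z')`, where the Heisenberg group has the law
`(v, c) (v', c') = (v + v', c + c' + ω (v, v') / 2)` with `ω (v, v') = ∑ Im (conj vⱼ * v'ⱼ)`,
corresponding to the brackets `[Xⱼ, Yⱼ] = Z`. -/
instance : Mul (Warped n) := ⟨fun s t =>
  mk (s.rot * t.rot) (s.vec + (s.rot : ℂ) • t.vec)
    (s.ht + t.ht + (inner ℂ s.vec ((s.rot : ℂ) • t.vec) : ℂ).im / 2)⟩

instance : One (Warped n) := ⟨mk 1 0 0⟩

instance : Inv (Warped n) := ⟨fun s => mk s.rot⁻¹ (-(((s.rot⁻¹ : Circle) : ℂ) • s.vec)) (-s.ht)⟩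

@[simp] lemma rot_mul (s t : Warped n) : (s * t).rot = s.rot * t.rot := rfl
@[simp] lemma vec_mul (s t : Warped n) : (s * t).vec = s.vec + (s.rot : ℂ) • t.vec := rfl
@[simp] lemma ht_mul (s t : Warped n) :
    (s * t).ht = s.ht + t.ht + (inner ℂ s.vec ((s.rot : ℂ) • t.vec) : ℂ).im / 2 := rfl
@[simp] lemma rot_one : (1 : Warped n).rot = 1 := rfl
@[simp] lemma vec_one : (1 : Warped n).vec = 0 := rfl
@[simp] lemma ht_one : (1 : Warped n).ht = 0 := rfl
@[simp] lemma rot_inv (s : Warped n) : (s⁻¹).rot = s.rot⁻¹ := rfl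
@[simp] lemma vec_inv (s : Warped n) : (s⁻¹).vec = -(((s.rot⁻¹ : Circle) : ℂ) • s.vec) := rfl
@[simp] lemma ht_inv (s : Warped n) : (s⁻¹).ht = -s.ht := rfl

lemma inner_circle_smul (z : Circle) (v w : EuclideanSpace ℂ (Fin n)) :
    inner ℂ ((z : ℂ) • v) ((z : ℂ) • w) = inner ℂ v w := by
  rw [inner_smul_left, inner_smul_right, ← mul_assoc, ← Complex.normSq_eq_conj_mul_self]
  simp

lemma im_inner_self (v : EuclideanSpace ℂ (Fin n)) : (inner ℂ v v : ℂ).im = 0 :=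
  inner_self_im (𝕜 := ℂ) v

instance : Group (Warped n) := Group.ofLeftAxioms
  (by
    intro a b c
    ext1
    · simp [mul_assoc]
    · simp [smul_smul, add_assoc]
    · simp only [ht_mul, vec_mul, rot_mul, Circle.coe_mul, smul_add, inner_add_left,
        inner_add_right, Complex.add_im, ← smul_smul, inner_circle_smul]
      ring)
  (by
    intro a
    ext1 <;> simp)
  (by
    intro a
    ext1
    · simp
    · simp
    · simp only [ht_mul, vec_inv, rot_inv, ht_inv, inner_neg_left, inner_circle_smul,
        Complex.neg_im, im_inner_self]
      simp)

/-- The embedding of `S` in the vector space `ℂ × (ℂⁿ × ℝ)`. -/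
def coord (s : Warped n) : ℂ × HeisModel n := ((s.rot : ℂ), (s.vec, s.ht))

lemma contMDiff_rot : ContMDiff (modelS n) (𝓡 1) ∞ (rot : Warped n → Circle) := contMDiff_fst

lemma contMDiff_coord : ContMDiff (modelS n) 𝓘(ℝ, ℂ × HeisModel n) ∞ (coord : Warped n → _) := by
  have h1 : ContMDiff (modelS n) 𝓘(ℝ, ℂ) ∞ (fun s : Warped n => (s.rot : ℂ)) :=
    haveI := finrank_real_complex_fact'
    (contMDiff_coe_sphere (E := ℂ) (n := 1)).comp contMDiff_rot
  have h2 : ContMDiff (modelS n) 𝓘(ℝ, HeisModel n) ∞ (fun s : Warped n => (s.vec, s.ht)) :=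
    contMDiff_snd (M := Circle) (N := HeisModel n)
  exact h1.prodMk_space h2

instance : LieGroup (modelS n) ∞ (Warped n) where
  contMDiff_mul := by
    have h1 : ContMDiff ((modelS n).prod (modelS n)) (𝓡 1) ∞
      (fun p : Warped n × Warped n => p.1.rot * p.2.rot) :=
      (contMDiff_rot.comp contMDiff_fst).mul (contMDiff_rot.comp contMDiff_snd)
    have hF : ContDiff ℝ ∞ (fun p : (ℂ × HeisModel n) × (ℂ × HeisModel n) =>
       ((p.1.2.1 + p.1.1 • p.2.2.1, p.1.2.2 + p.2.2.2 +
         (inner ℂ p.1.2.1 (p.1.1 • p.2.2.1) : ℂ).im / 2) : HeisModel n)) := by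
      have : ContDiff ℝ ∞ Complex.im := Complex.imCLM.contDiff
      have h3 : ContDiff ℝ ∞ (fun p : (ℂ × HeisModel n) × (ℂ × HeisModel n) =>
       ((inner ℂ p.1.2.1 (p.1.1 • p.2.2.1) : ℂ).im)) := by
        refine this.comp (ContDiff.inner ℂ (by fun_prop) (by fun_prop))
      fun_prop
    exact h1.prodMk (hF.comp_contMDiff ((contMDiff_coord.comp contMDiff_fst).prodMk_space
      (contMDiff_coord.comp contMDiff_snd)))
  contMDiff_inv := by
    have h1 : ContMDiff (modelS n) (𝓡 1) ∞ (fun p : Warped n => p.rot⁻¹) := contMDiff_rot.inv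
    have h2 : ContMDiff (modelS n) 𝓘(ℝ, ℂ) ∞ (fun s : Warped n => ((s.rot⁻¹ : Circle) : ℂ)) :=
      haveI := finrank_real_complex_fact'
      (contMDiff_coe_sphere (E := ℂ) (n := 1)).comp h1
    have hF : ContDiff ℝ ∞ (fun p : ℂ × (ℂ × HeisModel n) =>
       ((-(p.1 • p.2.2.1), - p.2.2.2) : HeisModel n)) := by fun_prop
    exact h1.prodMk (hF.comp_contMDiff (h2.prodMk_space contMDiff_coord))

instance : IsTopologicalGroup (Warped n) := topologicalGroup_of_lieGroup (modelS n) ∞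

/-- Coordinates on the Lie algebra: the vector `a W + ∑ pⱼ Xⱼ + ∑ qⱼ Yⱼ + r Z` is sent to
`(i a, (p + i q, r))`. Here `W` is the velocity at `t = 0` of `t ↦ exp (i t)` in the circle. -/
def lieCoord (a : TangentSpace (modelS n) (1 : Warped n)) : ℂ × HeisModel n :=
  mfderiv (modelS n) 𝓘(ℝ, ℂ × HeisModel n) coord (1 : Warped n) a

/-- The inner product on the Lie algebra for which `X₁, …, Xₙ, Y₁, …, Yₙ` are orthonormal, `Z` and
`W` are isotropic and orthogonal to all `Xⱼ`, `Yⱼ`, and `⟨W, Z⟩ = 1`. -/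
def lieForm (a b : TangentSpace (modelS n) (1 : Warped n)) : ℝ :=
  (lieCoord a).1.im * (lieCoord b).2.2 + (lieCoord b).1.im * (lieCoord a).2.2
    + (inner ℂ (lieCoord a).2.1 (lieCoord b).2.1 : ℂ).re

/-- The left-invariant metric `θ` on `S` given by `lieForm` at the identity. It is bi-invariant:
see `theta_mul_left` and `theta_mul_right`. -/
def theta (s : Warped n) (u v : TangentSpace (modelS n) s) : ℝ :=
  lieForm (mfderiv (modelS n) (modelS n) (fun t : Warped n => s⁻¹ * t) s u)
    (mfderiv (modelS n) (modelS n) (fun t : Warped n => s⁻¹ * t) s v)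

lemma mdifferentiableAt_coord (s : Warped n) :
    MDifferentiableAt (modelS n) 𝓘(ℝ, ℂ × HeisModel n) coord s :=
  contMDiff_coord.mdifferentiableAt (by simp)

lemma mdifferentiableAt_mul_left (g s : Warped n) :
    MDifferentiableAt (modelS n) (modelS n) (fun t : Warped n => g * t) s :=
  (contMDiff_mul_left (I := modelS n) (n := ∞) (a := g)).mdifferentiableAt (by simp)

lemma mdifferentiableAt_mul_right (g s : Warped n) :
    MDifferentiableAt (modelS n) (modelS n) (fun t : Warped n => t * g) s :=
  (contMDiff_mul_right (I := modelS n) (n := ∞) (a := g)).mdifferentiableAt (by simp)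

/-- The differential of `coord`, with values in the vector space. -/
def dcoord (s : Warped n) (u : TangentSpace (modelS n) s) : ℂ × HeisModel n :=
  mfderiv (modelS n) 𝓘(ℝ, ℂ × HeisModel n) coord s u

lemma dcoord_comp {F : Warped n → Warped n} {A : ℂ × HeisModel n → ℂ × HeisModel n}
    {A' : (ℂ × HeisModel n) →L[ℝ] (ℂ × HeisModel n)} {s : Warped n}
    (hF : MDifferentiableAt (modelS n) (modelS n) F s)
    (hA : HasFDerivAt A A' (coord s)) (h : ∀ t, coord (F t) = A (coord t))
    (u : TangentSpace (modelS n) s) :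
    dcoord (F s) (mfderiv (modelS n) (modelS n) F s u) = A' (dcoord s u) := by
  have h1 := ((mdifferentiableAt_coord (F s)).hasMFDerivAt.comp s hF.hasMFDerivAt).mfderiv
  have h2 := (hA.hasMFDerivAt.comp s (mdifferentiableAt_coord s).hasMFDerivAt).mfderiv
  have h3 : coord ∘ F = A ∘ coord := funext h
  rw [h3] at h1
  exact DFunLike.congr_fun (h1.symm.trans h2) u

lemma dcoord_mul_left (g s : Warped n) (u : TangentSpace (modelS n) s) :
    dcoord (g * s) (mfderiv (modelS n) (modelS n) (fun t : Warped n => g * t) s u) =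
      ((g.rot : ℂ) * (dcoord s u).1, ((g.rot : ℂ) • (dcoord s u).2.1,
        (dcoord s u).2.2 + (inner ℂ g.vec ((g.rot : ℂ) • (dcoord s u).2.1) : ℂ).im / 2)) := by
  let B : EuclideanSpace ℂ (Fin n) →L[ℝ] ℝ :=
    (Complex.imCLM ∘L ((innerSL ℂ g.vec).restrictScalars ℝ))
  let A' : (ℂ × HeisModel n) →L[ℝ] (ℂ × HeisModel n) :=
    ((g.rot : ℂ) • ContinuousLinearMap.fst ℝ ℂ (HeisModel n)).prod
      (((g.rot : ℂ) • (ContinuousLinearMap.fst ℝ _ _ ∘L ContinuousLinearMap.snd ℝ ℂ (HeisModel n))).prod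
       ((ContinuousLinearMap.snd ℝ _ _ ∘L ContinuousLinearMap.snd ℝ ℂ (HeisModel n)) +
         (2⁻¹ : ℝ) • (B ∘L ((g.rot : ℂ) • (ContinuousLinearMap.fst ℝ _ _ ∘L ContinuousLinearMap.snd ℝ ℂ (HeisModel n))))))
  rw [dcoord_comp (A := fun p => A' p + (0, (g.vec, g.ht))) (A' := A')
    (mdifferentiableAt_mul_left g s) (A'.hasFDerivAt.add_const _)]
  · simp [A', B]; ring
  · intro t
    simp [A', B, coord]
    constructor
    · rw [add_comm]
    · ring

lemma dcoord_mul_right (s g : Warped n) (u : TangentSpace (modelS n) s) :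
    dcoord (s * g) (mfderiv (modelS n) (modelS n) (fun t : Warped n => t * g) s u) =
      ((dcoord s u).1 * (g.rot : ℂ), ((dcoord s u).2.1 + (dcoord s u).1 • g.vec,
        (dcoord s u).2.2 + ((inner ℂ (dcoord s u).2.1 ((s.rot : ℂ) • g.vec) : ℂ).im
          + (inner ℂ s.vec ((dcoord s u).1 • g.vec) : ℂ).im) / 2)) := by
  have h1 : HasFDerivAt (fun p : ℂ × HeisModel n => p.1) (ContinuousLinearMap.fst ℝ ℂ (HeisModel n))
      (coord s) := hasFDerivAt_fst
  have h2 : HasFDerivAt (fun p : ℂ × HeisModel n => p.2) (ContinuousLinearMap.snd ℝ ℂ (HeisModel n))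
      (coord s) := hasFDerivAt_snd
  have h3 := h2.fst
  have h4 := h2.snd
  have h5 := h1.smul_const g.vec
  have h6 := (Complex.imCLM.hasFDerivAt.comp (coord s) (h3.inner ℂ h5)).mul_const (2⁻¹ : ℝ)
  have h7 := (h1.mul_const (g.rot : ℂ)).prodMk ((h3.add h5).prodMk ((h4.add_const g.ht).add h6))
  refine (dcoord_comp (mdifferentiableAt_mul_right g s) h7 ?_ u).trans ?_
  · intro t
    simp [coord, inner_smul_right]
    ring
  · simp [fderivInnerCLM_apply, coord, inner_smul_right]
    constructor <;> ring

/-- Vectors tangent to the circle at `z` are real multiples of `i z`. -/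
lemma dcoord_fst (s : Warped n) (u : TangentSpace (modelS n) s) :
    (dcoord s u).1 = ((starRingEnd ℂ (s.rot : ℂ) * (dcoord s u).1).im : ℂ) * Complex.I * s.rot := by
  have h1 : HasFDerivAt (fun p : ℂ × HeisModel n => p.1) (ContinuousLinearMap.fst ℝ ℂ (HeisModel n))
      (coord s) := hasFDerivAt_fst
  have h2 := (h1.inner ℂ h1).hasMFDerivAt.comp s (mdifferentiableAt_coord s).hasMFDerivAt
  have h3 : (fun p : ℂ × HeisModel n => (inner ℂ p.1 p.1 : ℂ)) ∘ (coord : Warped n → _) =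
      fun _ => 1 := by
    funext t
    simp only [Function.comp_apply, coord, RCLike.inner_apply', ← Complex.normSq_eq_conj_mul_self]
    simp
  rw [h3] at h2
  have h4 := DFunLike.congr_fun (h2.mfderiv.symm.trans mfderiv_const) u
  have h5 : (inner ℂ (s.rot : ℂ) (dcoord s u).1 : ℂ) + inner ℂ (dcoord s u).1 (s.rot : ℂ) = 0 := h4
  have h6 : (starRingEnd ℂ (s.rot : ℂ) * (dcoord s u).1).re = 0 := by
    have := congrArg Complex.re h5
    simp at this ⊢
    linarith
  have h7 : starRingEnd ℂ (s.rot : ℂ) * (dcoord s u).1 =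
      ((starRingEnd ℂ (s.rot : ℂ) * (dcoord s u).1).im : ℂ) * Complex.I := by
    apply Complex.ext <;> simp [h6]
  rw [← h7, mul_right_comm, ← Complex.normSq_eq_conj_mul_self]
  simp

/-- The metric `theta` in coordinates. -/
lemma theta_eq (s : Warped n) (u v : TangentSpace (modelS n) s) :
    theta s u v =
      (starRingEnd ℂ (s.rot : ℂ) * (dcoord s u).1).im *
          ((dcoord s v).2.2 - (inner ℂ s.vec (dcoord s v).2.1 : ℂ).im / 2)
      + (starRingEnd ℂ (s.rot : ℂ) * (dcoord s v).1).im *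
          ((dcoord s u).2.2 - (inner ℂ s.vec (dcoord s u).2.1 : ℂ).im / 2)
      + (inner ℂ (dcoord s u).2.1 (dcoord s v).2.1 : ℂ).re := by
  have key : ∀ u : TangentSpace (modelS n) s,
      lieCoord (mfderiv (modelS n) (modelS n) (fun t : Warped n => s⁻¹ * t) s u) =
      (starRingEnd ℂ (s.rot : ℂ) * (dcoord s u).1, ((starRingEnd ℂ (s.rot : ℂ)) • (dcoord s u).2.1,
        (dcoord s u).2.2 - (inner ℂ s.vec (dcoord s u).2.1 : ℂ).im / 2)) := by
    intro u
    have h := dcoord_mul_left s⁻¹ s u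
    have h' : ∀ (a : ModelVS n), dcoord (s⁻¹ * s) a = lieCoord (n := n) a := by
      intro a
      rw [inv_mul_cancel]; rfl
    refine (h' _).symm.trans (h.trans ?_)
    rw [rot_inv, vec_inv, inner_neg_left, inner_circle_smul, Circle.coe_inv_eq_conj, Complex.neg_im]
    ring_nf
  unfold theta lieForm
  rw [key, key]
  have : ∀ v w : EuclideanSpace ℂ (Fin n), inner ℂ ((starRingEnd ℂ (s.rot : ℂ)) • v)
    ((starRingEnd ℂ (s.rot : ℂ)) • w) = inner ℂ v w := fun v w => by
      rw [← Circle.coe_inv_eq_conj, inner_circle_smul]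
  simp only [this]

lemma theta_mul_right (s g : Warped n) (u v : TangentSpace (modelS n) s) :
    theta (s * g) (mfderiv (modelS n) (modelS n) (fun t : Warped n => t * g) s u)
      (mfderiv (modelS n) (modelS n) (fun t : Warped n => t * g) s v) = theta s u v := by
  rw [theta_eq, theta_eq, dcoord_mul_right, dcoord_mul_right]
  have hu := dcoord_fst s u
  have hv := dcoord_fst s v
  set a := (starRingEnd ℂ (s.rot : ℂ) * (dcoord s u).1).im
  set b := (starRingEnd ℂ (s.rot : ℂ) * (dcoord s v).1).im
  have e1 : ∀ ζ : ℂ, starRingEnd ℂ ((s * g).rot : ℂ) * (ζ * g.rot) = starRingEnd ℂ (s.rot : ℂ) * ζ := by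
    intro ζ
    have : starRingEnd ℂ (g.rot : ℂ) * g.rot = 1 := by
      rw [← Complex.normSq_eq_conj_mul_self]; simp
    rw [rot_mul, Circle.coe_mul, map_mul]
    linear_combination (starRingEnd ℂ (s.rot : ℂ) * ζ) * this
  simp only [e1, vec_mul]
  have e0 : ∀ a : ℝ, (starRingEnd ℂ (s.rot : ℂ) * ((a : ℂ) * Complex.I * s.rot)).im = a := by
    intro a
    have : starRingEnd ℂ (s.rot : ℂ) * ((a : ℂ) * Complex.I * s.rot) = a * Complex.I := by
      rw [mul_left_comm, ← Complex.normSq_eq_conj_mul_self]; simp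
    rw [this]; simp
  rw [hu, hv]
  generalize (dcoord s u).2.1 = w
  generalize (dcoord s v).2.1 = w'
  generalize (dcoord s u).2.2 = r
  generalize (dcoord s v).2.2 = r'
  have e2 : ∀ a : ℝ, ((a : ℂ) * Complex.I * (s.rot : ℂ)) • g.vec = (a : ℂ) • (Complex.I • ((s.rot : ℂ) • g.vec)) :=
    fun a => by simp only [smul_smul, mul_assoc]
  simp only [e2]
  generalize (s.rot : ℂ) • g.vec = x
  have c1 : ∀ y : EuclideanSpace ℂ (Fin n), (inner ℂ x y : ℂ).im = -(inner ℂ y x : ℂ).im :=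
    fun y => by rw [← inner_conj_symm x y, Complex.conj_im]
  simp only [inner_add_left, inner_add_right, inner_smul_left, inner_smul_right, e0,
    Complex.conj_ofReal, Complex.conj_I, Complex.add_im, Complex.add_re, Complex.re_ofReal_mul,
    Complex.im_ofReal_mul, Complex.I_mul_re, Complex.I_mul_im, neg_mul, Complex.neg_re,
    Complex.neg_im, mul_neg, c1 w, c1 w']
  ring

lemma theta_mul_left (g s : Warped n) (u v : TangentSpace (modelS n) s) :
    theta (g * s) (mfderiv (modelS n) (modelS n) (fun t : Warped n => g * t) s u)
      (mfderiv (modelS n) (modelS n) (fun t : Warped n => g * t) s v) = theta s u v := by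
  rw [theta_eq, theta_eq, dcoord_mul_left, dcoord_mul_left]
  have e1 : ∀ ζ : ℂ, starRingEnd ℂ ((g * s).rot : ℂ) * (g.rot * ζ) = starRingEnd ℂ (s.rot : ℂ) * ζ := by
    intro ζ
    have : starRingEnd ℂ (g.rot : ℂ) * g.rot = 1 := by
      rw [← Complex.normSq_eq_conj_mul_self]; simp
    rw [rot_mul, Circle.coe_mul, map_mul]
    linear_combination (starRingEnd ℂ (s.rot : ℂ) * ζ) * this
  simp only [e1, vec_mul, inner_add_left, inner_circle_smul, Complex.add_im]
  ring

end Warped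

section Quotient
open Warped
variable {n : ℕ} (Γ : Subgroup (Warped n)) [hΓ : DiscreteTopology Γ]

lemma isLocalHomeomorph_mk :
    IsLocalHomeomorph (QuotientGroup.mk : Warped n → Warped n ⧸ Γ) :=
  (Γ.isQuotientCoveringMap ⟨hΓ⟩).isCoveringMap.isLocalHomeomorph

/-- The manifold structure on `S / Γ` for a discrete subgroup `Γ`, obtained by pushing forward the
charts of `S` along the covering `S → S / Γ`; the covering is a local diffeomorphism, see
`isLocalDiffeomorph_mk`. -/
instance : ChartedSpace (ModelHS n) (Warped n ⧸ Γ) :=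
  (isLocalHomeomorph_mk Γ).chartedSpace QuotientGroup.mk_surjective

lemma eventually_localInverseAt_mk (s₀ s : Warped n)
    (hs : (s : Warped n ⧸ Γ) ∈ ((isLocalHomeomorph_mk Γ).localInverseAt s₀).source) :
    ∃ γ ∈ Γ, ∀ᶠ t : Warped n in 𝓝 s, (isLocalHomeomorph_mk Γ).localInverseAt s₀ (t : Warped n ⧸ Γ) = t * γ := by
  set hf := isLocalHomeomorph_mk Γ
  set L := hf.localInverseAt s₀
  have h1 : ((L (s : Warped n ⧸ Γ) : Warped n) : Warped n ⧸ Γ) = s := hf.apply_localInverseAt_of_mem hs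
  refine ⟨s⁻¹ * L s, QuotientGroup.eq.1 h1.symm, ?_⟩
  have hγ : s⁻¹ * L s ∈ Γ := QuotientGroup.eq.1 h1.symm
  have e1 : ∀ᶠ t : Warped n in 𝓝 s, (t : Warped n ⧸ Γ) ∈ L.source :=
    hf.continuous.continuousAt.preimage_mem_nhds (L.open_source.mem_nhds hs)
  have e2 : ∀ᶠ t : Warped n in 𝓝 s, t * (s⁻¹ * L s) ∈ L.target := by
    have : ContinuousAt (fun t : Warped n => t * (s⁻¹ * L s)) s := by fun_prop
    refine this.eventually (L.open_target.mem_nhds ?_)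
    simpa using L.map_source hs
  filter_upwards [e1, e2] with t h1 h2
  refine hf.injOn_localInverseAt_target (L.map_source h1) h2 ?_
  rw [hf.apply_localInverseAt_of_mem h1]
  exact (QuotientGroup.mk_mul_of_mem t hγ).symm

lemma contDiffOn_of_contMDiffOn_model {E H : Type*} [NormedAddCommGroup E] [NormedSpace ℝ E]
    [TopologicalSpace H] (I : ModelWithCorners ℝ E H) {f : H → H} {u : Set H}
    (h : ContMDiffOn I I ∞ f u) : ContDiffOn ℝ ∞ (I ∘ f ∘ I.symm) (I.symm ⁻¹' u ∩ Set.range I) := by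
  rintro x ⟨hx, y, rfl⟩
  have := (contMDiffOn_iff.1 h).2 y y
  simp only [mfld_simps, chartAt_self_eq, Set.preimage_univ, Set.inter_univ] at this
  rw [Set.inter_comm]
  refine (this (I y) ?_).mono ?_
  · simpa using hx
  · rintro z ⟨hz, hz'⟩
    simpa using ⟨hz, hz'⟩

instance : IsManifold (modelS n) ∞ (Warped n ⧸ Γ) := by
  refine isManifold_of_contDiffOn _ _ _ ?_
  rintro _ _ ⟨q, rfl⟩ ⟨q', rfl⟩
  set hf := isLocalHomeomorph_mk Γ
  set g := (QuotientGroup.mk_surjective (s := Γ)).hasRightInverse.choose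
  set c := chartAt (ModelHS n) (g q)
  set c' := chartAt (ModelHS n) (g q')
  set L := hf.localInverseAt (g q) with hL
  set L' := hf.localInverseAt (g q') with hL'
  have key : ContMDiffOn (modelS n) (modelS n) ∞ ((L.trans c).symm.trans (L'.trans c'))
      ((L.trans c).symm.trans (L'.trans c')).source := by
    intro x hx
    have hLs : ∀ t, L.symm t = (t : Warped n ⧸ Γ) := fun t => by
      rw [hL, hf.localInverseAt_symm]
    have hx' : (x ∈ c.target ∧ c.symm x ∈ L.target) ∧
        ((c.symm x : Warped n) : Warped n ⧸ Γ) ∈ L'.source ∧ L' (c.symm x : Warped n) ∈ c'.source := by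
      simpa [hLs] using hx
    obtain ⟨⟨a1, a2⟩, a3, a4⟩ := hx'
    obtain ⟨γ, -, hev⟩ := eventually_localInverseAt_mk Γ (g q') (c.symm x) a3
    have s1 : ContMDiffAt (modelS n) (modelS n) ∞ c.symm x :=
      (contMDiffOn_symm_of_mem_maximalAtlas
        (IsManifold.chart_mem_maximalAtlas (g q))).contMDiffAt (c.open_target.mem_nhds a1)
    have s2 : ContMDiffAt (modelS n) (modelS n) ∞ (fun t : Warped n => t * γ) (c.symm x) :=
      contMDiff_mul_right.contMDiffAt
    have s3 : ContMDiffAt (modelS n) (modelS n) ∞ c' (c.symm x * γ) := by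
      refine (contMDiffOn_of_mem_maximalAtlas
        (IsManifold.chart_mem_maximalAtlas (g q'))).contMDiffAt (c'.open_source.mem_nhds ?_)
      rw [← hev.self_of_nhds]; exact a4
    refine ContMDiffAt.contMDiffWithinAt ?_
    refine (s3.comp x (s2.comp x s1)).congr_of_eventuallyEq ?_
    filter_upwards [s1.continuousAt.eventually hev] with y hy
    simp only [OpenPartialHomeomorph.coe_trans, OpenPartialHomeomorph.coe_trans_symm,
      Function.comp_apply, hLs]
    exact congrArg c' hy
  exact contDiffOn_of_contMDiffOn_model _ key

lemma contMDiff_mk : ContMDiff (modelS n) (modelS n) ∞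
    (QuotientGroup.mk : Warped n → Warped n ⧸ Γ) := by
  intro s
  set hf := isLocalHomeomorph_mk Γ
  set g := (QuotientGroup.mk_surjective (s := Γ)).hasRightInverse.choose
  have hg : ((g (s : Warped n ⧸ Γ) : Warped n) : Warped n ⧸ Γ) = s :=
    (QuotientGroup.mk_surjective (s := Γ)).hasRightInverse.choose_spec s
  set p := g (s : Warped n ⧸ Γ)
  set c := chartAt (ModelHS n) p
  set L := hf.localInverseAt p with hL
  have hLs : ∀ t, L.symm t = (t : Warped n ⧸ Γ) := fun t => by
    rw [hL, hf.localInverseAt_symm]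
  have hsL : (s : Warped n ⧸ Γ) ∈ L.source := by
    rw [← hg]; exact hf.apply_self_mem_localInverseAt_source
  have hLp : L (s : Warped n ⧸ Γ) = p := by
    rw [← hg]; exact hf.localInverseAt_apply_self
  obtain ⟨γ, -, hev⟩ := eventually_localInverseAt_mk Γ p s hsL
  have hsγ : s * γ = p := hev.self_of_nhds.symm.trans hLp
  have s1 : ContMDiffAt (modelS n) (modelS n) ∞ (fun t : Warped n => t * γ) s :=
    contMDiff_mul_right.contMDiffAt
  have s2 : ContMDiffAt (modelS n) (modelS n) ∞ c (s * γ) := by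
    rw [hsγ]
    exact (contMDiffOn_of_mem_maximalAtlas
      (IsManifold.chart_mem_maximalAtlas p)).contMDiffAt (c.open_source.mem_nhds (mem_chart_source _ p))
  have s3 : ContMDiffAt (modelS n) (modelS n) ∞ (L.trans c).symm (c (s * γ)) := by
    have h := contMDiffOn_symm_of_mem_maximalAtlas (I := modelS n) (n := ∞)
      (IsManifold.chart_mem_maximalAtlas (I := modelS n) (n := ∞) (s : Warped n ⧸ Γ))
    refine h.contMDiffAt ((chartAt (ModelHS n) (s : Warped n ⧸ Γ)).open_target.mem_nhds ?_)
    have := mem_chart_target (ModelHS n) (s : Warped n ⧸ Γ)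
    have e : (chartAt (ModelHS n) (s : Warped n ⧸ Γ)) s = c (s * γ) := by
      rw [hsγ]
      exact congrArg c hLp
    rwa [← e]
  refine (s3.comp s (s2.comp s s1)).congr_of_eventuallyEq ?_
  have e3 : ∀ᶠ t : Warped n in 𝓝 s, t * γ ∈ c.source := by
    refine s1.continuousAt.preimage_mem_nhds (c.open_source.mem_nhds ?_)
    rw [hsγ]; exact mem_chart_source _ p
  have e1 : ∀ᶠ t : Warped n in 𝓝 s, (t : Warped n ⧸ Γ) ∈ L.source :=
    hf.continuous.continuousAt.preimage_mem_nhds (L.open_source.mem_nhds hsL)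
  filter_upwards [e3, hev, e1] with t h3 ht h1
  simp only [OpenPartialHomeomorph.coe_trans_symm, Function.comp_apply, hLs]
  refine Eq.trans ?_ (congrArg (fun a : Warped n => (a : Warped n ⧸ Γ)) (c.left_inv h3).symm)
  rw [← ht]
  exact (hf.apply_localInverseAt_of_mem h1).symm

lemma contMDiffOn_localInverseAt (s₀ : Warped n) :
    ContMDiffOn (modelS n) (modelS n) ∞ ((isLocalHomeomorph_mk Γ).localInverseAt s₀)
      ((isLocalHomeomorph_mk Γ).localInverseAt s₀).source := by
  intro q hq
  refine ContMDiffAt.contMDiffWithinAt ?_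
  obtain ⟨s, rfl⟩ := QuotientGroup.mk_surjective q
  set hf := isLocalHomeomorph_mk Γ
  set g := (QuotientGroup.mk_surjective (s := Γ)).hasRightInverse.choose
  have hg : ((g (s : Warped n ⧸ Γ) : Warped n) : Warped n ⧸ Γ) = s :=
    (QuotientGroup.mk_surjective (s := Γ)).hasRightInverse.choose_spec s
  set p := g (s : Warped n ⧸ Γ)
  rw [← hg] at hq ⊢
  set c := chartAt (ModelHS n) p
  set L := hf.localInverseAt p with hL
  have hLp : L (p : Warped n ⧸ Γ) = p := hf.localInverseAt_apply_self
  have hpL : (p : Warped n ⧸ Γ) ∈ L.source := hf.apply_self_mem_localInverseAt_source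
  obtain ⟨γ, -, hev⟩ := eventually_localInverseAt_mk Γ s₀ p hq
  have s1 : ContMDiffAt (modelS n) (modelS n) ∞ (fun t : Warped n => t * γ) p :=
    contMDiff_mul_right.contMDiffAt
  have s2 : ContMDiffAt (modelS n) (modelS n) ∞ c.symm (c p) :=
    (contMDiffOn_symm_of_mem_maximalAtlas
      (IsManifold.chart_mem_maximalAtlas p)).contMDiffAt
        (c.open_target.mem_nhds (mem_chart_target _ p))
  have s3 : ContMDiffAt (modelS n) (modelS n) ∞ (L.trans c) (p : Warped n ⧸ Γ) := by
    have h := contMDiffOn_of_mem_maximalAtlas (I := modelS n) (n := ∞)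
      (IsManifold.chart_mem_maximalAtlas (I := modelS n) (n := ∞) (s : Warped n ⧸ Γ))
    rw [hg]
    exact h.contMDiffAt ((chartAt (ModelHS n) (s : Warped n ⧸ Γ)).open_source.mem_nhds
      (mem_chart_source _ _))
  have s4 : ContMDiffAt (modelS n) (modelS n) ∞ (fun q : Warped n ⧸ Γ => c.symm (c (L q)))
      (p : Warped n ⧸ Γ) := by
    refine ContMDiffAt.comp (p : Warped n ⧸ Γ) (g := c.symm) (f := L.trans c) ?_ s3
    have : (L.trans c) (p : Warped n ⧸ Γ) = c p := congrArg c hLp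
    rwa [this]
  have e0 : ∀ᶠ q : Warped n ⧸ Γ in 𝓝 (p : Warped n ⧸ Γ), c.symm (c (L q)) = L q := by
    have : ContinuousAt L (p : Warped n ⧸ Γ) := L.continuousAt hpL
    have h := this.preimage_mem_nhds (c.open_source.mem_nhds (by rw [hLp]; exact mem_chart_source _ p))
    filter_upwards [h] with q hq using c.left_inv hq
  have s5 : ContMDiffAt (modelS n) (modelS n) ∞ L (p : Warped n ⧸ Γ) :=
    s4.congr_of_eventuallyEq (e0.mono fun _ h => h.symm)
  have s6 : ContMDiffAt (modelS n) (modelS n) ∞ (fun q => L q * γ) (p : Warped n ⧸ Γ) :=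
    contMDiff_mul_right.contMDiffAt.comp _ s5
  refine s6.congr_of_eventuallyEq ?_
  have hc : Filter.Tendsto L (𝓝 (p : Warped n ⧸ Γ)) (𝓝 p) := by
    have := (L.continuousAt hpL).tendsto
    rwa [hLp] at this
  filter_upwards [hc.eventually hev, L.open_source.mem_nhds hpL] with q h1 h2
  rw [← h1, hf.apply_localInverseAt_of_mem h2]

lemma isLocalDiffeomorph_mk : IsLocalDiffeomorph (modelS n) (modelS n) ∞
    (QuotientGroup.mk : Warped n → Warped n ⧸ Γ) := by
  intro s
  set hf := isLocalHomeomorph_mk Γ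
  refine ⟨{ toPartialEquiv := (hf.localInverseAt s).symm.toPartialEquiv
            open_source := (hf.localInverseAt s).open_target
            open_target := (hf.localInverseAt s).open_source
            contMDiffOn_toFun := ?_
            contMDiffOn_invFun := contMDiffOn_localInverseAt Γ s },
            hf.self_mem_localInverseAt_target, ?_⟩
  · have : ((hf.localInverseAt s).symm : Warped n → Warped n ⧸ Γ) = QuotientGroup.mk :=
      hf.localInverseAt_symm s
    change ContMDiffOn (modelS n) (modelS n) ∞ (hf.localInverseAt s).symm _
    rw [this]
    exact (contMDiff_mk Γ).contMDiffOn
  · intro t _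
    exact (congrFun (hf.localInverseAt_symm s) t).symm

/-- The rescaled metric `m θ` on `S`, where `m` is a function on the circle `H \ S`, pulled back
to `S`. -/
def conformalMetric (m : Circle → ℝ) (s : Warped n) (u v : TangentSpace (modelS n) s) : ℝ :=
  m s.rot * theta s u v

/-- The metric on `S / Γ` induced by `m θ`: tangent vectors are lifted along the covering to a point
over the given point. For `Γ` contained in `H` this does not depend on that point: see
`quotientMetric_mk`. -/
def quotientMetric (m : Circle → ℝ) (x : Warped n ⧸ Γ) (a b : TangentSpace (modelS n) x) : ℝ :=
  conformalMetric m x.out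
    ((mfderiv (modelS n) (modelS n) (QuotientGroup.mk : Warped n → Warped n ⧸ Γ) x.out).inverse a)
    ((mfderiv (modelS n) (modelS n) (QuotientGroup.mk : Warped n → Warped n ⧸ Γ) x.out).inverse b)

/-- The Heisenberg group `H` as a (closed, normal) subgroup of `S`. -/
def heisenberg (n : ℕ) : Subgroup (Warped n) where
  carrier := {s | s.rot = 1}
  mul_mem' {a b} ha hb := by
    simp only [Set.mem_ofPred_eq] at ha hb ⊢
    simp [ha, hb]
  one_mem' := rfl
  inv_mem' {a} ha := by
    simp only [Set.mem_ofPred_eq] at ha ⊢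
    simp [ha]

/-- The metric `m θ` descends: the covering `S → S / Γ` is a local isometry. -/
lemma quotientMetric_mk (hH : Γ ≤ heisenberg n) (m : Circle → ℝ) (s : Warped n)
    (u v : TangentSpace (modelS n) s) :
    quotientMetric Γ m (s : Warped n ⧸ Γ)
      (mfderiv (modelS n) (modelS n) (QuotientGroup.mk : Warped n → Warped n ⧸ Γ) s u)
      (mfderiv (modelS n) (modelS n) (QuotientGroup.mk : Warped n → Warped n ⧸ Γ) s v) =
    conformalMetric m s u v := by
  have hout : ((Quotient.out (s : Warped n ⧸ Γ) : Warped n) : Warped n ⧸ Γ) = s :=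
    QuotientGroup.out_eq' _
  obtain ⟨γ, hγ, hsγ⟩ : ∃ γ ∈ Γ, Quotient.out (s : Warped n ⧸ Γ) = s * γ :=
    ⟨s⁻¹ * Quotient.out (s : Warped n ⧸ Γ), QuotientGroup.eq.1 hout.symm, by group⟩
  have hcomp : (QuotientGroup.mk : Warped n → Warped n ⧸ Γ) ∘ (fun t => t * γ) = QuotientGroup.mk :=
    funext fun t => QuotientGroup.mk_mul_of_mem t hγ
  have hd := mfderiv_comp (I := modelS n) (I' := modelS n) (I'' := modelS n) s
    (((contMDiff_mk Γ).mdifferentiable (by simp)) (s * γ)) (mdifferentiableAt_mul_right γ s)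
  rw [hcomp] at hd
  have hinv : ∀ u : TangentSpace (modelS n) s,
      (mfderiv (modelS n) (modelS n) (QuotientGroup.mk : Warped n → Warped n ⧸ Γ) (s * γ)).inverse
      (mfderiv (modelS n) (modelS n) (QuotientGroup.mk : Warped n → Warped n ⧸ Γ) s u) =
      mfderiv (modelS n) (modelS n) (fun t => t * γ) s u := by
    intro u
    have h1 := DFunLike.congr_fun hd u
    have h2 := (isLocalDiffeomorph_mk Γ).mfderivToContinuousLinearEquiv_coe (by simp) (s * γ)
    rw [← h2, ContinuousLinearMap.inverse_equiv]
    refine (ContinuousLinearEquiv.symm_apply_eq _).2 ?_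
    exact h1
  have hrot : (s * γ).rot = s.rot := by
    have : γ.rot = 1 := hH hγ
    simp [this]
  unfold quotientMetric
  rw [hsγ]
  unfold conformalMetric
  rw [hrot, ← theta_mul_right s γ]
  congr 2
  · exact hinv u
  · exact hinv v

/-- The group of isometries of `S / Γ` with the metric induced by `m θ`: the diffeomorphisms that
preserve the metric. -/
def isomGroup (m : Circle → ℝ) : Subgroup ((Warped n ⧸ Γ) ≃ₜ (Warped n ⧸ Γ)) where
  carrier := {f | ContMDiff (modelS n) (modelS n) ∞ f ∧ ContMDiff (modelS n) (modelS n) ∞ f.symm ∧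
    ∀ (x : Warped n ⧸ Γ) (a b : TangentSpace (modelS n) x),
      quotientMetric Γ m (f x) (mfderiv (modelS n) (modelS n) f x a)
        (mfderiv (modelS n) (modelS n) f x b) = quotientMetric Γ m x a b}
  mul_mem' := by
    rintro f g ⟨hf, hf', hfm⟩ ⟨hg, hg', hgm⟩
    refine ⟨hf.comp hg, hg'.comp hf', fun x a b => ?_⟩
    have h := mfderiv_comp (g := f) (f := g) (I := modelS n) (I' := modelS n) (I'' := modelS n) x
      (hf.mdifferentiable (by simp) (g x)) (hg.mdifferentiable (by simp) x)
    have hfg : ((f * g : (Warped n ⧸ Γ) ≃ₜ (Warped n ⧸ Γ)) : Warped n ⧸ Γ → Warped n ⧸ Γ) =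
      f ∘ g := rfl
    rw [hfg, h]
    exact (hfm (g x) _ _).trans (hgm x a b)
  one_mem' := by
    refine ⟨contMDiff_id, contMDiff_id, fun x a b => ?_⟩
    have h1 : ((1 : (Warped n ⧸ Γ) ≃ₜ (Warped n ⧸ Γ)) : Warped n ⧸ Γ → Warped n ⧸ Γ) = id := rfl
    rw [h1, mfderiv_id]
    rfl
  inv_mem' := by
    rintro f ⟨hf, hf', hfm⟩
    refine ⟨hf', hf, fun x a b => ?_⟩
    obtain ⟨y, rfl⟩ := f.surjective x
    have h := mfderiv_comp (I := modelS n) (I' := modelS n) (I'' := modelS n) (f y)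
      (hf.mdifferentiable (by simp) (f.symm (f y))) (hf'.mdifferentiable (by simp) (f y))
    have hc : f ∘ f.symm = id := funext f.apply_symm_apply
    rw [hc, mfderiv_id] at h
    have key : ∀ a : TangentSpace (modelS n) (f y),
        mfderiv (modelS n) (modelS n) f (f.symm (f y))
          (mfderiv (modelS n) (modelS n) f.symm (f y) a) = a :=
      fun a => (DFunLike.congr_fun h a).symm
    have h2 := hfm (f.symm (f y)) (mfderiv (modelS n) (modelS n) f.symm (f y) a)
      (mfderiv (modelS n) (modelS n) f.symm (f y) b)
    rw [key, key] at h2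
    refine h2.symm.trans ?_
    rw [f.apply_symm_apply]

/-- The compact-open topology on the isometry group. -/
instance (m : Circle → ℝ) : TopologicalSpace (isomGroup Γ m) :=
  .induced (fun f => (f.1 : C(Warped n ⧸ Γ, Warped n ⧸ Γ))) ContinuousMap.compactOpen

end Quotient

section CentralPart

variable {n : ℕ} (Γ : Subgroup (Warped n))

/-- The subgroup `Λ = Z(H) ∩ Γ` of `H`. -/
def centralPart : Subgroup (heisenberg n) :=
  Subgroup.center (heisenberg n) ⊓ Γ.subgroupOf (heisenberg n)

instance : (centralPart Γ).Normal :=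
  ⟨fun a ha g => by rwa [Subgroup.mem_center_iff.1 ha.1 g, mul_inv_cancel_right]⟩

end CentralPart

end WarpedHeisenberg

end

/-!
The group `H` acts on `S / Γ` by isometries because `θ` is bi-invariant and `m` is constant along
the orbits of `H`; the kernel of the action is `Λ` (`ker_heisenbergAction`). What has to be shown is
that every isometry `f` close to the identity is the action of an element of `H` close to `1`
(`eventually_mem_heisenberg`). Then the image of `H` is an open, hence closed, connected subgroup of
the isometry group, that is, its identity component, and `H / Λ` carries the topology induced from
the isometry group.

Since `S / Γ` is compact, distinct small elements of `S` displace all its points differently. So an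
`f` that is close to the identity has a unique lift `F s = u s`, with `u` small depending on `s`;
it is a local isometry of `m θ` commuting with right translation by `Γ` (`exists_isNearIsometry`).
The claim is that `u` is constant and lies in `H` (`IsNearIsometry.eq_left_translation`). Neither
curvature nor Killing fields are needed for that:

* `dF Z` is a nonzero null vector, so its `W`-component has a constant weak sign along each orbit of
  `Z`. These orbits close up in `S / Γ`, as `Γ` contains a central element, and the circle component
  of `F` does not wind along them. So the `W`-component is zero, and `dF Z` is a multiple of `Z`
  (`angSpeed_center`).
* Hence `F` preserves `Z⊥`, that is, it maps fibres of `S → H \ S` to fibres and induces a map `τ`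
  of the circle. On a fibre, `F` induces a similarity of `ℂⁿ` of ratio `√(m / m ∘ τ)`, which commutes
  up to rotations with translations by the vectors of `Γ`; so the ratio is at least one
  (`m_rot_le`).
* Commuting with the central element of `Γ`, `F` satisfies `dF Z = Z` (`fderiv_pullHt_center`), and
  then `⟨W, Z⟩ = 1` shows that `τ` has speed `m / m ∘ τ ≥ 1`. As `τ` has degree one, its speed is one
  (`angSpeed_one`). So `τ` is a rotation preserving `m`, that is, the identity (`rot_map`).
* Now `F` contracts the fibres and commutes with translations by a spanning set of vectors, so it
  acts on the `ℂⁿ` component of each fibre by a translation (`pullVec_eq`). The remaining isometry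
  equations and the equivariance under `Γ` show that this translation does not depend on the fibre
  (`fderiv_pullVec_horizontal`), and determine the central component (`pullHt_eq`).
-/

noncomputable section

namespace WarpedHeisenberg
open Warped

/-! ### Two lemmas on functions of one variable -/

/-- The components `q`, `ζ` along `W` and `Z` of a curve of nonzero null vectors satisfy the two
hypotheses; the curve stays in one half of the null cone, so that each of them has a weak sign. -/
lemma forall_nonneg_or_forall_nonpos {q ζ : ℝ → ℝ} (hq : Continuous q) (hζ : Continuous ζ)
    (hle : ∀ x, q x * ζ x ≤ 0) (hne : ∀ x, q x = 0 → ζ x ≠ 0) :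
    (∀ x, 0 ≤ q x) ∨ (∀ x, q x ≤ 0) := by
  -- `q - ζ` is a time function on the null cone: it vanishes at no nonzero null vector
  have h0 : ∀ x, q x - ζ x ≠ 0 := by
    intro x hx
    have h1 : q x = ζ x := by linarith
    have h2 := hle x
    rw [← h1] at h2
    have h3 : q x = 0 := by nlinarith [mul_self_nonneg (q x)]
    exact hne x h3 (by rw [← h1, h3])
  by_contra! hcon
  obtain ⟨⟨a, ha⟩, b, hb⟩ := hcon
  have ha' : q a - ζ a ≤ 0 := by
    by_contra! h
    nlinarith [hle a]
  have hb' : 0 ≤ q b - ζ b := by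
    by_contra! h
    nlinarith [hle b]
  obtain ⟨x, hx⟩ := mem_range_of_exists_le_of_exists_ge (hq.sub hζ) ⟨a, ha'⟩ ⟨b, hb'⟩
  exact h0 x hx

/-- A periodic curve in the slit plane whose argument is monotone has constant argument: it has
no room to wind around the origin. -/
lemma angular_speed_eq_zero {w : ℝ → ℂ} {q : ℝ → ℝ} {T : ℝ} (hT : 0 < T)
    (hw : ∀ x, HasDerivAt w ((q x : ℂ) * Complex.I * w x) x)
    (hslit : ∀ x, w x ∈ Complex.slitPlane) (hper : ∀ x, w (x + T) = w x)
    (hq : (∀ x, 0 ≤ q x) ∨ (∀ x, q x ≤ 0)) (x : ℝ) : q x = 0 := by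
  set y : ℝ → ℝ := fun x => (Complex.log (w x)).im with hy
  have hd : ∀ x, HasDerivAt y (q x) x := by
    intro x
    have h1 := (hw x).clog_real (hslit x)
    rw [mul_div_cancel_right₀ _ (Complex.slitPlane_ne_zero (hslit x))] at h1
    have h2 : HasDerivAt y ((q x : ℂ) * Complex.I).im x :=
      Complex.imCLM.hasFDerivAt.comp_hasDerivAt x h1
    simpa using h2
  have hdiff : Differentiable ℝ y := fun x => (hd x).differentiableAt
  have hperk : ∀ x (k : ℕ), y (x + k * T) = y x := by
    intro x k
    induction k with
    | zero => simp
    | succ k ih =>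
      rw [← ih]
      simp only [hy]
      rw [← hper (x + k * T)]
      push_cast
      ring_nf
  have hconst : ∀ a b, a ≤ b → y a = y b := by
    intro a b hab
    obtain ⟨k, hk⟩ := exists_nat_ge ((b - a) / T)
    have hk' : b ≤ a + k * T := by
      rw [div_le_iff₀ hT] at hk; linarith
    rcases hq with hq | hq
    · have hm : Monotone y := monotone_of_deriv_nonneg hdiff fun x => by rw [(hd x).deriv]; exact hq x
      exact le_antisymm (hm hab) ((hm hk').trans_eq (hperk a k))
    · have hm : Antitone y := antitone_of_deriv_nonpos hdiff fun x => by rw [(hd x).deriv]; exact hq x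
      exact le_antisymm ((hperk a k).symm.trans_le (hm hk')) (hm hab)
  have hc : y = fun _ => y 0 := by
    funext z
    rcases le_total z 0 with h | h
    · exact hconst z 0 h
    · exact (hconst 0 z h).symm
  have h1 := hd x
  rw [hc] at h1
  exact h1.unique (hasDerivAt_const x _)

variable {n : ℕ}

/-! ### Coordinates on the warped Heisenberg group -/

/-- Global coordinates `(t, v, c) ↦ (exp (i t), v, c)` on `S`, periodic in `t`. -/
def param (p : ℝ × HeisModel n) : Warped n := mk (Circle.exp p.1) p.2.1 p.2.2

lemma param_surjective : Function.Surjective (param (n := n)) := by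
  intro s
  obtain ⟨t, ht⟩ := Circle.exp_surjective s.rot
  exact ⟨(t, s.vec, s.ht), by ext1 <;> simp [param, ht]⟩

lemma contMDiff_param : ContMDiff 𝓘(ℝ, ℝ × HeisModel n) (modelS n) ∞ (param (n := n)) := by
  have h1 : ContMDiff 𝓘(ℝ, ℝ × HeisModel n) (𝓡 1) ∞ (fun p : ℝ × HeisModel n => Circle.exp p.1) :=
    _root_.contMDiff_circleExp.comp contDiff_fst.contMDiff
  exact h1.prodMk (contDiff_snd.contMDiff (f := (Prod.snd : ℝ × HeisModel n → HeisModel n)))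

/-- The circle component of `F` in the coordinates `param`. -/
def pullRot (F : Warped n → Warped n) (p : ℝ × HeisModel n) : ℂ := (F (param p)).rot
/-- The `ℂⁿ` component of `F` in the coordinates `param`. -/
def pullVec (F : Warped n → Warped n) (p : ℝ × HeisModel n) : EuclideanSpace ℂ (Fin n) :=
  (F (param p)).vec
/-- The central component of `F` in the coordinates `param`. -/
def pullHt (F : Warped n → Warped n) (p : ℝ × HeisModel n) : ℝ := (F (param p)).ht

/-- The angular speed of the circle component of `F` at `p` in the direction `e`, that is, the
`W`-component of the image of `e` under `dF`. -/
def angSpeed (F : Warped n → Warped n) (p e : ℝ × HeisModel n) : ℝ :=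
  (starRingEnd ℂ (pullRot F p) * fderiv ℝ (pullRot F) p e).im

/-- The contact form `dc - ω (v, dv) / 2` evaluated on the image under `dF` of the direction `e`. -/
def contact (F : Warped n → Warped n) (p e : ℝ × HeisModel n) : ℝ :=
  fderiv ℝ (pullHt F) p e - (inner ℂ (pullVec F p) (fderiv ℝ (pullVec F) p e) : ℂ).im / 2

section Smooth
variable {F : Warped n → Warped n} (hF : ContMDiff (modelS n) (modelS n) ∞ F)
include hF

lemma contDiff_coord_param : ContDiff ℝ ∞ (fun p => coord (F (param p))) :=
  (contMDiff_coord.comp (hF.comp contMDiff_param)).contDiff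

lemma contDiff_pullRot : ContDiff ℝ ∞ (pullRot F) := (contDiff_coord_param hF).fst
lemma contDiff_pullVec : ContDiff ℝ ∞ (pullVec F) := (contDiff_coord_param hF).snd.fst
lemma contDiff_pullHt : ContDiff ℝ ∞ (pullHt F) := (contDiff_coord_param hF).snd.snd

lemma differentiable_pullRot : Differentiable ℝ (pullRot F) :=
  (contDiff_pullRot hF).differentiable (by simp)
lemma differentiable_pullVec : Differentiable ℝ (pullVec F) :=
  (contDiff_pullVec hF).differentiable (by simp)
lemma differentiable_pullHt : Differentiable ℝ (pullHt F) :=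
  (contDiff_pullHt hF).differentiable (by simp)

lemma dcoord_param (p e : ℝ × HeisModel n) :
    dcoord (F (param p)) (mfderiv (modelS n) (modelS n) F (param p)
      (mfderiv 𝓘(ℝ, ℝ × HeisModel n) (modelS n) param p e)) =
    (fderiv ℝ (pullRot F) p e, (fderiv ℝ (pullVec F) p e, fderiv ℝ (pullHt F) p e)) := by
  have h1 := ((mdifferentiableAt_coord (F (param p))).hasMFDerivAt.comp (param p)
    (hF.mdifferentiable (by simp) (param p)).hasMFDerivAt).comp p
    (contMDiff_param.mdifferentiable (by simp) p).hasMFDerivAt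
  have h2 := ((differentiable_pullRot hF p).hasFDerivAt.prodMk
    ((differentiable_pullVec hF p).hasFDerivAt.prodMk
      (differentiable_pullHt hF p).hasFDerivAt)).hasMFDerivAt
  exact DFunLike.congr_fun (hasMFDerivAt_unique h1 h2) e

lemma fderiv_pullRot (p e : ℝ × HeisModel n) :
    fderiv ℝ (pullRot F) p e = (angSpeed F p e : ℂ) * Complex.I * pullRot F p := by
  have h := dcoord_fst (F (param p)) (mfderiv (modelS n) (modelS n) F (param p)
      (mfderiv 𝓘(ℝ, ℝ × HeisModel n) (modelS n) param p e))
  rw [dcoord_param hF] at h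
  exact h

/-- The metric `θ` on images of coordinate vectors under `dF`. -/
lemma theta_pull (p e e' : ℝ × HeisModel n) :
    theta (F (param p)) (mfderiv (modelS n) (modelS n) F (param p)
      (mfderiv 𝓘(ℝ, ℝ × HeisModel n) (modelS n) param p e))
      (mfderiv (modelS n) (modelS n) F (param p)
      (mfderiv 𝓘(ℝ, ℝ × HeisModel n) (modelS n) param p e')) =
    angSpeed F p e * contact F p e' + angSpeed F p e' * contact F p e
      + (inner ℂ (fderiv ℝ (pullVec F) p e) (fderiv ℝ (pullVec F) p e') : ℂ).re := by
  rw [theta_eq, dcoord_param hF, dcoord_param hF]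
  rfl

end Smooth

lemma pullRot_id (p : ℝ × HeisModel n) : pullRot id p = Complex.exp (p.1 * Complex.I) := by
  simp [pullRot, param]

lemma hasFDerivAt_exp_fst (p : ℝ × HeisModel n) :
    HasFDerivAt (fun p : ℝ × HeisModel n => Complex.exp (p.1 * Complex.I))
      ((ContinuousLinearMap.fst ℝ ℝ (HeisModel n)).smulRight
        (Complex.I * Complex.exp (p.1 * Complex.I))) p := by
  have h : HasDerivAt (fun t : ℝ => Complex.exp (t * Complex.I))
      (Complex.I * Complex.exp (p.1 * Complex.I)) p.1 := by
    have h1 : HasDerivAt (fun t : ℝ => (t : ℂ) * Complex.I) Complex.I p.1 := by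
      simpa using (Complex.ofRealCLM.hasDerivAt (x := p.1)).mul_const Complex.I
    simpa [mul_comm] using h1.cexp
  have h2 := h.hasFDerivAt.comp p (hasFDerivAt_fst (𝕜 := ℝ) (E := ℝ) (F := HeisModel n) (p := p))
  refine h2.congr_fderiv ?_
  ext <;> simp

lemma conj_exp_mul_exp (t : ℝ) :
    starRingEnd ℂ (Complex.exp (t * Complex.I)) * Complex.exp (t * Complex.I) = 1 := by
  rw [← Complex.exp_conj, ← Complex.exp_add]
  simp

lemma angSpeed_id (p e : ℝ × HeisModel n) : angSpeed id p e = e.1 := by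
  have h : pullRot (n := n) id = fun p => Complex.exp (p.1 * Complex.I) := funext pullRot_id
  rw [angSpeed, h, (hasFDerivAt_exp_fst p).fderiv]
  have : starRingEnd ℂ (Complex.exp (p.1 * Complex.I)) *
      (e.1 • (Complex.I * Complex.exp (p.1 * Complex.I))) = e.1 * Complex.I := by
    rw [Complex.real_smul]
    linear_combination (e.1 * Complex.I) * conj_exp_mul_exp p.1
  refine (congrArg Complex.im this).trans ?_
  simp

lemma fderiv_pullVec_id (p e : ℝ × HeisModel n) : fderiv ℝ (pullVec id) p e = e.2.1 := by
  have h : HasFDerivAt (pullVec (n := n) id)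
      (ContinuousLinearMap.fst ℝ _ _ ∘L ContinuousLinearMap.snd ℝ ℝ (HeisModel n)) p :=
    (ContinuousLinearMap.fst ℝ _ _ ∘L ContinuousLinearMap.snd ℝ ℝ (HeisModel n)).hasFDerivAt
  rw [h.fderiv]; rfl

lemma contact_id (p e : ℝ × HeisModel n) :
    contact id p e = e.2.2 - (inner ℂ p.2.1 e.2.1 : ℂ).im / 2 := by
  have h : HasFDerivAt (pullHt (n := n) id)
      (ContinuousLinearMap.snd ℝ _ _ ∘L ContinuousLinearMap.snd ℝ ℝ (HeisModel n)) p :=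
    (ContinuousLinearMap.snd ℝ _ _ ∘L ContinuousLinearMap.snd ℝ ℝ (HeisModel n)).hasFDerivAt
  rw [contact, h.fderiv, fderiv_pullVec_id]; rfl

/-! ### Cocompact discrete subgroups of the Heisenberg group -/

lemma continuous_rot : Continuous (rot : Warped n → Circle) := contMDiff_rot.continuous
lemma continuous_coord : Continuous (coord : Warped n → _) := contMDiff_coord.continuous
lemma continuous_vec : Continuous (vec : Warped n → _) := continuous_coord.snd.fst

section Lattice
variable {Γ : Subgroup (Warped n)} (hΓ : Γ ≤ heisenberg n)
include hΓ

lemma rot_of_mem {γ : Warped n} (hγ : γ ∈ Γ) : γ.rot = 1 := hΓ hγ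

/-- The projection to `ℂⁿ` of a cocompact subgroup of `H` spans `ℂⁿ` over the reals: a linear form
vanishing on it would descend to an unbounded continuous function on `S / Γ`. -/
lemma eq_zero_of_re_inner_vec [CompactSpace (Warped n ⧸ Γ)] {y : EuclideanSpace ℂ (Fin n)}
    (hy : ∀ γ ∈ Γ, (inner ℂ y γ.vec : ℂ).re = 0) : y = 0 := by
  -- undoing the rotation makes the linear form invariant under right translation by `Γ`
  let φ : Warped n → ℝ := fun s => (inner ℂ y (((s.rot⁻¹ : Circle) : ℂ) • s.vec) : ℂ).re
  have hφ : Continuous φ := by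
    have h1 : Continuous fun s : Warped n => ((s.rot⁻¹ : Circle) : ℂ) :=
      continuous_subtype_val.comp continuous_rot.inv
    exact Complex.continuous_re.comp (continuous_const.inner (h1.smul continuous_vec))
  have hinv : ∀ s t : Warped n, (QuotientGroup.leftRel Γ) s t → φ s = φ t := by
    intro s t hst
    rw [QuotientGroup.leftRel_apply] at hst
    obtain ⟨γ, hγ, rfl⟩ : ∃ γ ∈ Γ, t = s * γ := ⟨_, hst, by group⟩
    have h1 := rot_of_mem hΓ hγ
    have h2 : ((s.rot : ℂ))⁻¹ * s.rot = 1 := inv_mul_cancel₀ (Circle.coe_ne_zero _)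
    simp only [φ, rot_mul, h1, mul_one, vec_mul, smul_add, smul_smul, Circle.coe_inv, h2, one_smul,
      inner_add_right, Complex.add_re, hy γ hγ, add_zero]
  let ψ : Warped n ⧸ Γ → ℝ := Quotient.lift φ hinv
  have hψ : Continuous ψ := hφ.quotient_lift hinv
  obtain ⟨C, hC⟩ := (isCompact_range hψ).bddAbove
  have hval : ∀ r : ℝ, φ (mk 1 ((r : ℂ) • y) 0) = r * ‖y‖ ^ 2 := by
    intro r
    have : (inner ℂ y y : ℂ).re = ‖y‖ ^ 2 := inner_self_eq_norm_sq (𝕜 := ℂ) y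
    simp only [φ, rot_mk, vec_mk, inv_one, Circle.coe_one, inner_smul_right,
      one_mul, Complex.re_ofReal_mul, this]
  by_contra hne
  have hpos : 0 < ‖y‖ ^ 2 := by positivity
  have h := hC ⟨(mk 1 ((((C + 1) / ‖y‖ ^ 2 : ℝ) : ℂ) • y) 0 : Warped n), rfl⟩
  have h' : φ (mk 1 ((((C + 1) / ‖y‖ ^ 2 : ℝ) : ℂ) • y) 0) ≤ C := h
  rw [hval, div_mul_cancel₀ _ hpos.ne'] at h'
  linarith

lemma exists_mem_vec_ne_zero (hn : 1 ≤ n) [CompactSpace (Warped n ⧸ Γ)] :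
    ∃ γ ∈ Γ, γ.vec ≠ 0 := by
  by_contra! h
  have : Nonempty (Fin n) := ⟨⟨0, hn⟩⟩
  obtain ⟨y, hy⟩ := exists_ne (0 : EuclideanSpace ℂ (Fin n))
  exact hy (eq_zero_of_re_inner_vec hΓ fun γ hγ => by simp [h γ hγ])

/-- A cocompact subgroup of `H` contains a nontrivial central element, namely a commutator. -/
lemma exists_central_mem (hn : 1 ≤ n) [CompactSpace (Warped n ⧸ Γ)] :
    ∃ c : ℝ, 0 < c ∧ mk 1 0 c ∈ Γ := by
  obtain ⟨γ, hγ, hne⟩ := exists_mem_vec_ne_zero hΓ hn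
  obtain ⟨δ, hδ, hne'⟩ : ∃ δ ∈ Γ, (inner ℂ γ.vec δ.vec : ℂ).im ≠ 0 := by
    by_contra! h
    -- `Im ⟪γ, δ⟫` is the real inner product of `i γ` and `δ`, so that it vanishes for all `δ` only
    -- if `γ` has no `ℂⁿ` component
    have h0 := eq_zero_of_re_inner_vec hΓ (y := Complex.I • γ.vec) fun δ hδ => by
      simp [h δ hδ]
    exact hne ((smul_eq_zero.1 h0).resolve_left Complex.I_ne_zero)
  have hcomm : γ * δ * γ⁻¹ * δ⁻¹ = mk 1 0 (inner ℂ γ.vec δ.vec : ℂ).im := by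
    have h1 := rot_of_mem hΓ hγ
    have h2 := rot_of_mem hΓ hδ
    have h3 : (inner ℂ δ.vec γ.vec : ℂ).im = -(inner ℂ γ.vec δ.vec : ℂ).im := by
      rw [← inner_conj_symm, Complex.conj_im]
    ext1
    · simp [h1, h2]
    · simp [h1, h2]
    · simp only [ht_mul, vec_mul, rot_mul, rot_inv, vec_inv, ht_inv, h1, h2, inv_one, mul_one,
        Circle.coe_one, one_smul, inner_neg_right, inner_add_left, inner_neg_left, Complex.add_im,
        Complex.neg_im, im_inner_self, h3, ht_mk]
      ring
  have hmem : mk 1 0 (inner ℂ γ.vec δ.vec : ℂ).im ∈ Γ :=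
    hcomm ▸ Γ.mul_mem (Γ.mul_mem (Γ.mul_mem hγ hδ) (Γ.inv_mem hγ)) (Γ.inv_mem hδ)
  rcases lt_or_gt_of_ne hne' with h | h
  · refine ⟨_, neg_pos.2 h, ?_⟩
    convert Γ.inv_mem hmem using 1
    ext1 <;> simp
  · exact ⟨_, h, hmem⟩

end Lattice

/-! ### Lifted isometries preserve the central direction -/

lemma param_mul (p : ℝ × HeisModel n) {γ : Warped n} (hγ : γ.rot = 1) :
    param p * γ = param (p.1, (p.2.1 + (Circle.exp p.1 : ℂ) • γ.vec,
      p.2.2 + γ.ht + (inner ℂ p.2.1 ((Circle.exp p.1 : ℂ) • γ.vec) : ℂ).im / 2)) := by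
  ext1 <;> simp [param, hγ]

lemma continuous_fderiv_comp_line {E : Type*} [NormedAddCommGroup E] [NormedSpace ℝ E]
    {f : ℝ × HeisModel n → E} (hf : ContDiff ℝ ∞ f) (p e : ℝ × HeisModel n) :
    Continuous fun x : ℝ => fderiv ℝ f (p + x • e) e := by
  have h := hf.continuous_fderiv (by simp)
  have h2 : Continuous fun x : ℝ => p + x • e := by fun_prop
  exact (h.comp h2).clm_apply continuous_const

lemma eq_of_fderiv_fibre_eq_zero {E : Type*} [NormedAddCommGroup E] [NormedSpace ℝ E]
    {f : ℝ × HeisModel n → E} (hf : Differentiable ℝ f) (t : ℝ)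
    (h : ∀ q e, fderiv ℝ f (t, q) (0, e) = 0) (q q' : HeisModel n) : f (t, q) = f (t, q') := by
  have h1 : ∀ q, HasFDerivAt (fun q => f (t, q))
      ((fderiv ℝ f (t, q)).comp (ContinuousLinearMap.inr ℝ ℝ (HeisModel n))) q := fun q =>
    (hf (t, q)).hasFDerivAt.comp q (hasFDerivAt_prodMk_right t q)
  exact is_const_of_fderiv_eq_zero (𝕜 := ℝ) (fun q => (h1 q).differentiableAt)
    (fun q => by rw [(h1 q).fderiv]; exact ContinuousLinearMap.ext (h q)) q q'

/-- A smooth map `F : S → S` which is a local isometry of `m θ`, commutes with right translations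
by `Γ`, and moves the circle component of each point by an angle less than `π / 2`. These are
the lifts to `S` of isometries of `S / Γ` close to the identity. -/
structure IsNearIsometry (Γ : Subgroup (Warped n)) (m : Circle → ℝ) (F : Warped n → Warped n) :
    Prop where
  contMDiff : ContMDiff (modelS n) (modelS n) ∞ F
  map_mul : ∀ s, ∀ γ ∈ Γ, F (s * γ) = F s * γ
  isometry : ∀ (s : Warped n) (u v : TangentSpace (modelS n) s),
    conformalMetric m (F s) (mfderiv (modelS n) (modelS n) F s u)
      (mfderiv (modelS n) (modelS n) F s v) = conformalMetric m s u v
  near : ∀ s, 0 < (((F s * s⁻¹).rot : Circle) : ℂ).re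

namespace IsNearIsometry
variable {Γ : Subgroup (Warped n)} {m : Circle → ℝ} {F : Warped n → Warped n}
  (hF : IsNearIsometry Γ m F)
include hF

/-- The isometry equation in the coordinates `param`. -/
lemma metric_eq (p e e' : ℝ × HeisModel n) :
    m (F (param p)).rot * (angSpeed F p e * contact F p e' + angSpeed F p e' * contact F p e
      + (inner ℂ (fderiv ℝ (pullVec F) p e) (fderiv ℝ (pullVec F) p e') : ℂ).re) =
    m (Circle.exp p.1) * (e.1 * (e'.2.2 - (inner ℂ p.2.1 e'.2.1 : ℂ).im / 2) +
      e'.1 * (e.2.2 - (inner ℂ p.2.1 e.2.1 : ℂ).im / 2) + (inner ℂ e.2.1 e'.2.1 : ℂ).re) := by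
  have h := hF.isometry (param p) (mfderiv 𝓘(ℝ, ℝ × HeisModel n) (modelS n) param p e)
    (mfderiv 𝓘(ℝ, ℝ × HeisModel n) (modelS n) param p e')
  have h2 := theta_pull (F := (id : Warped n → Warped n)) contMDiff_id p e e'
  rw [mfderiv_id] at h2
  unfold conformalMetric at h
  rw [theta_pull hF.contMDiff] at h
  refine h.trans (congrArg _ (h2.trans ?_))
  simp only [angSpeed_id, contact_id, fderiv_pullVec_id]

/-- The isometry equation on the diagonal. -/
lemma metric_self (p e : ℝ × HeisModel n) :
    m (F (param p)).rot * (2 * (angSpeed F p e * contact F p e)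
      + ‖fderiv ℝ (pullVec F) p e‖ ^ 2) =
    m (Circle.exp p.1) * (2 * (e.1 * (e.2.2 - (inner ℂ p.2.1 e.2.1 : ℂ).im / 2)) +
      ‖e.2.1‖ ^ 2) := by
  have h := hF.metric_eq p e e
  have h1 : ∀ y : EuclideanSpace ℂ (Fin n), (inner ℂ y y : ℂ).re = ‖y‖ ^ 2 :=
    inner_self_eq_norm_sq (𝕜 := ℂ)
  rw [h1, h1] at h
  linear_combination h

section
variable (hpos : ∀ z, 0 < m z)
include hpos

/-- `dF` is injective, so the null vector `dF Z` cannot have both `Z`- and `W`-component zero. -/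
lemma contact_ne_zero (p : ℝ × HeisModel n) (h : angSpeed F p (0, (0, 1)) = 0) :
    contact F p (0, (0, 1)) ≠ 0 := by
  intro h0
  have h1 := hF.metric_self p (0, (0, 1))
  have h2 := hF.metric_eq p (0, (0, 1)) (1, (0, 0))
  have h3 : fderiv ℝ (pullVec F) p (0, (0, 1)) = 0 := by
    have := hpos (F (param p)).rot
    simpa [h, h0, this.ne'] using h1
  have := hpos (Circle.exp p.1)
  simp [h, h0, h3] at h2
  exact this.ne h2

/-- `dF Z` is a null vector. -/
lemma angSpeed_mul_contact_nonpos (p : ℝ × HeisModel n) :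
    angSpeed F p (0, (0, 1)) * contact F p (0, (0, 1)) ≤ 0 := by
  have h1 := hF.metric_self p (0, (0, 1))
  have h2 := hpos (F (param p)).rot
  have h3 : 2 * (angSpeed F p (0, (0, 1)) * contact F p (0, (0, 1)))
      + ‖fderiv ℝ (pullVec F) p (0, (0, 1))‖ ^ 2 = 0 := by
    simpa [h2.ne'] using h1
  nlinarith [sq_nonneg ‖fderiv ℝ (pullVec F) p (0, (0, 1))‖]

end

lemma continuous_angSpeed (p e : ℝ × HeisModel n) :
    Continuous fun x : ℝ => angSpeed F (p + x • e) e := by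
  have h1 := continuous_fderiv_comp_line (contDiff_pullRot hF.contMDiff) p e
  have h2 := (contDiff_pullRot hF.contMDiff).continuous
  unfold angSpeed
  fun_prop

lemma continuous_contact (p e : ℝ × HeisModel n) :
    Continuous fun x : ℝ => contact F (p + x • e) e := by
  have h1 := continuous_fderiv_comp_line (contDiff_pullHt hF.contMDiff) p e
  have h2 := continuous_fderiv_comp_line (contDiff_pullVec hF.contMDiff) p e
  have h3 : Continuous fun x : ℝ => pullVec F (p + x • e) :=
    (contDiff_pullVec hF.contMDiff).continuous.comp (by fun_prop)
  unfold contact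
  exact h1.sub ((Complex.continuous_im.comp (h3.inner h2)).div_const 2)

/-- Derivative of the relative circle component along a line. -/
lemma hasDerivAt_relRot (p e : ℝ × HeisModel n) (x : ℝ) :
    HasDerivAt (fun x : ℝ => pullRot F (p + x • e) * Complex.exp (-((p.1 + x * e.1 : ℝ) * Complex.I)))
      (((angSpeed F (p + x • e) e - e.1 : ℝ) : ℂ) * Complex.I *
        (pullRot F (p + x • e) * Complex.exp (-((p.1 + x * e.1 : ℝ) * Complex.I)))) x := by
  have h0 : HasDerivAt (fun x : ℝ => p + x • e) e x := by
    simpa using ((hasDerivAt_id x).smul_const e).const_add p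
  have h1 := (differentiable_pullRot hF.contMDiff (p + x • e)).hasFDerivAt.comp_hasDerivAt x h0
  rw [fderiv_pullRot hF.contMDiff] at h1
  have h2 : HasDerivAt (fun x : ℝ => -(((p.1 + x * e.1 : ℝ) : ℂ) * Complex.I))
      (-((e.1 : ℂ) * Complex.I)) x := by
    have h3 : HasDerivAt (fun x : ℝ => p.1 + x * e.1) e.1 x := by
      simpa using ((hasDerivAt_id x).mul_const e.1).const_add p.1
    exact (h3.ofReal_comp.mul_const Complex.I).neg
  refine (h1.mul h2.cexp).congr_deriv ?_
  simp only [Function.comp_apply]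
  push_cast
  ring

lemma relRot_mem_slitPlane (p : ℝ × HeisModel n) :
    pullRot F p * Complex.exp (-((p.1 : ℝ) * Complex.I)) ∈ Complex.slitPlane := by
  refine Or.inl ?_
  have h := hF.near (param p)
  simpa [pullRot, param, Complex.exp_neg] using h

/-- If the circle component of a near isometry turns monotonically relative to the identity along
a line closing up in the quotient by `Γ` and by the period of the coordinates, it does not turn. -/
lemma angSpeed_eq_of_periodic (p e : ℝ × HeisModel n) {T : ℝ} (hT : 0 < T)
    (hper : ∀ x : ℝ, pullRot F (p + (x + T) • e) = pullRot F (p + x • e))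
    (hper' : Complex.exp (-((T * e.1 : ℝ) * Complex.I)) = 1)
    (hq : (∀ x : ℝ, e.1 ≤ angSpeed F (p + x • e) e) ∨ (∀ x : ℝ, angSpeed F (p + x • e) e ≤ e.1)) :
    angSpeed F p e = e.1 := by
  have h := angular_speed_eq_zero hT (hF.hasDerivAt_relRot p e) (fun x => ?_) (fun x => ?_) ?_ 0
  · simpa [sub_eq_zero] using h
  · simpa using hF.relRot_mem_slitPlane (p + x • e)
  · rw [hper]
    have : -(((p.1 + (x + T) * e.1 : ℝ) : ℂ) * Complex.I) =
      -((p.1 + x * e.1 : ℝ) * Complex.I) + -((T * e.1 : ℝ) * Complex.I) := by push_cast; ring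
    rw [this, Complex.exp_add, hper', mul_one]
  · exact hq.imp (fun h x => sub_nonneg.2 (h x)) (fun h x => sub_nonpos.2 (h x))

section
variable (hpos : ∀ z, 0 < m z) (hc : ∃ c : ℝ, 0 < c ∧ Warped.mk 1 0 c ∈ Γ)
include hpos hc

/-- The image of `Z` has no component along `W`: along a `Z`-orbit, which closes up modulo `Γ`, it
stays in one half of the null cone, so that its `W`-component has a constant weak sign; and this
component integrates to zero, because `F` moves points by small angles only. -/
lemma angSpeed_center (p : ℝ × HeisModel n) : angSpeed F p (0, (0, 1)) = 0 := by
  obtain ⟨c, hc0, hcΓ⟩ := hc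
  refine hF.angSpeed_eq_of_periodic p (0, (0, 1)) hc0 (fun x => ?_) (by simp) ?_
  · have h := hF.map_mul (param (p + x • ((0, (0, 1)) : ℝ × HeisModel n))) _ hcΓ
    rw [param_mul _ (by simp)] at h
    have h2 := congrArg (fun s : Warped n => (s.rot : ℂ)) h
    simp only [rot_mul, rot_mk, mul_one] at h2
    refine Eq.trans ?_ h2
    unfold pullRot
    congr 4
    ext1 <;> [skip; ext1] <;> simp [add_assoc]
  · exact forall_nonneg_or_forall_nonpos (hF.continuous_angSpeed p _) (hF.continuous_contact p _)
      (fun x => hF.angSpeed_mul_contact_nonpos hpos _) (fun x => hF.contact_ne_zero hpos _)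

lemma fderiv_pullVec_center (p : ℝ × HeisModel n) :
    fderiv ℝ (pullVec F) p (0, (0, 1)) = 0 := by
  have h1 := hF.metric_self p (0, (0, 1))
  have := hpos (F (param p)).rot
  simpa [hF.angSpeed_center hpos hc, this.ne'] using h1

lemma contact_center (p : ℝ × HeisModel n) :
    contact F p (0, (0, 1)) = fderiv ℝ (pullHt F) p (0, (0, 1)) := by
  simp [contact, hF.fderiv_pullVec_center hpos hc]

/-- The fibres of `S → H \ S` are orthogonal to `Z`, and hence `F` maps fibres to fibres. -/
lemma angSpeed_fibre (p : ℝ × HeisModel n) (e : HeisModel n) : angSpeed F p (0, e) = 0 := by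
  have h1 := hF.metric_eq p (0, e) (0, (0, 1))
  have h2 := hpos (F (param p)).rot
  have h3 := hF.angSpeed_center hpos hc p
  have h4 := hF.contact_ne_zero hpos p h3
  simpa [h3, h4, h2.ne', hF.fderiv_pullVec_center hpos hc] using h1

/-- The isometry equation for the pair `W`, `Z`. -/
lemma angSpeed_mul_contact (p : ℝ × HeisModel n) :
    m (F (param p)).rot * (angSpeed F p (1, 0) * fderiv ℝ (pullHt F) p (0, (0, 1))) =
      m (Circle.exp p.1) := by
  have h1 := hF.metric_eq p (1, 0) (0, (0, 1))
  simpa [hF.angSpeed_center hpos hc, hF.fderiv_pullVec_center hpos hc,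
    hF.contact_center hpos hc] using h1

end

end IsNearIsometry

/-! ### Lifted isometries are left translations -/

lemma eq_add_smul_of_fderiv_line_eq {E E' : Type*} [NormedAddCommGroup E] [NormedSpace ℝ E]
    [NormedAddCommGroup E'] [NormedSpace ℝ E'] {f : E → E'} (hf : Differentiable ℝ f) {p e : E}
    {a : E'} (h : ∀ x : ℝ, fderiv ℝ f (p + x • e) e = a) (x : ℝ) :
    f (p + x • e) = f p + x • a := by
  have h0 : ∀ x : ℝ, HasDerivAt (fun x : ℝ => f (p + x • e) - x • a) 0 x := by
    intro x
    have h1 : HasDerivAt (fun x : ℝ => p + x • e) e x := by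
      simpa using ((hasDerivAt_id x).smul_const e).const_add p
    have h2 := (hf (p + x • e)).hasFDerivAt.comp_hasDerivAt x h1
    rw [h] at h2
    have h3 : HasDerivAt (fun x : ℝ => f (p + x • e) - x • a) (a - (1 : ℝ) • a) x :=
      h2.sub ((hasDerivAt_id x).smul_const a)
    simpa using h3
  have h3 := is_const_of_deriv_eq_zero (fun x => (h0 x).differentiableAt) (fun x => (h0 x).deriv) x 0
  simp only [zero_smul, add_zero, sub_zero] at h3
  rw [← h3]; abel

lemma fderiv_eq_of_fibre_const {E : Type*} [NormedAddCommGroup E] [NormedSpace ℝ E]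
    {f : ℝ × HeisModel n → E} (h : ∀ t q q', f (t, q) = f (t, q')) (t : ℝ) (q q' : HeisModel n) :
    fderiv ℝ f (t, q) = fderiv ℝ f (t, q') := by
  have h1 := fderiv_comp_add_right (𝕜 := ℝ) (f := f) (x := (t, q)) ((0, q' - q) : ℝ × HeisModel n)
  have h2 : (fun x => f (x + ((0, q' - q) : ℝ × HeisModel n))) = f := by
    funext ⟨s, x⟩
    rw [Prod.mk_add_mk, add_zero]
    exact h _ _ _
  rw [h2] at h1
  simpa using h1

/-- Compare `v` with the points `w + k y` for large natural numbers `k`: a contraction commuting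
with the translation by `y` does not decrease the component along `y` of `v - w`. Together with the
same for `-y`, this component is preserved. -/
lemma inner_sub_le_of_contraction_of_equivariant {E : Type*} [NormedAddCommGroup E]
    [InnerProductSpace ℝ E] {A : E → E} (hA : ∀ v w, ‖A v - A w‖ ≤ ‖v - w‖) {y : E}
    (hy : ∀ v, A (v + y) = A v + y) (v w : E) : inner ℝ (v - w) y ≤ inner ℝ (A v - A w) y := by
  have hk : ∀ k : ℕ, A (w + k • y) = A w + k • y := by
    intro k
    induction k with
    | zero => simp
    | succ k ih => rw [succ_nsmul, ← add_assoc, hy, ih, add_assoc]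
  set a := A v - A w with ha
  set b := v - w with hb
  have h1 : ∀ k : ℕ, 2 * k * (inner ℝ b y - inner ℝ a y) ≤ ‖b‖ ^ 2 - ‖a‖ ^ 2 := by
    intro k
    have h2 := hA v (w + k • y)
    have h3 : A v - A (w + k • y) = a - (k : ℝ) • y := by
      rw [hk, ha, Nat.cast_smul_eq_nsmul]; abel
    have h4 : v - (w + k • y) = b - (k : ℝ) • y := by
      rw [hb, Nat.cast_smul_eq_nsmul]; abel
    rw [h3, h4] at h2
    have h5 := pow_le_pow_left₀ (norm_nonneg _) h2 2
    rw [norm_sub_sq_real a, norm_sub_sq_real b, inner_smul_right, inner_smul_right] at h5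
    linarith
  by_contra! hlt
  have hd : 0 < inner ℝ b y - inner ℝ a y := by linarith
  obtain ⟨k, hk⟩ := exists_nat_gt ((‖b‖ ^ 2 - ‖a‖ ^ 2) / (2 * (inner ℝ b y - inner ℝ a y)))
  rw [div_lt_iff₀ (by positivity)] at hk
  linarith [h1 k]

namespace IsNearIsometry
variable {Γ : Subgroup (Warped n)} {m : Circle → ℝ} {F : Warped n → Warped n}
  (hF : IsNearIsometry Γ m F)

include hF in
lemma map_param_mul (t : ℝ) (v : EuclideanSpace ℂ (Fin n)) (c : ℝ) {γ : Warped n} (hγ : γ ∈ Γ)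
    (h1 : γ.rot = 1) :
    F (param (t, (v + (Circle.exp t : ℂ) • γ.vec,
      c + γ.ht + (inner ℂ v ((Circle.exp t : ℂ) • γ.vec) : ℂ).im / 2))) =
      F (param (t, (v, c))) * γ := by
  rw [← hF.map_mul _ _ hγ, param_mul _ h1]

variable [CompactSpace (Warped n ⧸ Γ)] (hn : 1 ≤ n) (hΓ : Γ ≤ heisenberg n) (hpos : ∀ z, 0 < m z)

include hF hn hΓ hpos

lemma pullRot_fibre (t : ℝ) (q q' : HeisModel n) : pullRot F (t, q) = pullRot F (t, q') := by
  refine eq_of_fderiv_fibre_eq_zero (differentiable_pullRot hF.contMDiff) t (fun q e => ?_) q q'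
  rw [fderiv_pullRot hF.contMDiff, hF.angSpeed_fibre hpos (exists_central_mem hΓ hn)]
  simp

lemma rot_fibre (t : ℝ) (q q' : HeisModel n) : (F (param (t, q))).rot = (F (param (t, q'))).rot :=
  Circle.ext (hF.pullRot_fibre hn hΓ hpos t q q')

/-- The isometry equation on vectors tangent to the fibres. -/
lemma norm_fderiv_pullVec_fibre (p : ℝ × HeisModel n) (e : HeisModel n) :
    m (F (param p)).rot * ‖fderiv ℝ (pullVec F) p (0, e)‖ ^ 2 = m (Circle.exp p.1) * ‖e.1‖ ^ 2 := by
  have h := hF.metric_self p (0, e)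
  simpa [hF.angSpeed_fibre hpos (exists_central_mem hΓ hn)] using h

lemma pullVec_center (t : ℝ) (v : EuclideanSpace ℂ (Fin n)) (c c' : ℝ) :
    pullVec F (t, (v, c)) = pullVec F (t, (v, c')) := by
  have h := eq_add_smul_of_fderiv_line_eq (differentiable_pullVec hF.contMDiff) (p := (t, (v, c)))
    (fun x => hF.fderiv_pullVec_center hpos (exists_central_mem hΓ hn) _) (c' - c)
  simpa using h.symm

lemma pullVec_add (t : ℝ) (v : EuclideanSpace ℂ (Fin n)) {γ : Warped n} (hγ : γ ∈ Γ) :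
    pullVec F (t, (v + (Circle.exp t : ℂ) • γ.vec, 0)) =
      pullVec F (t, (v, 0)) + pullRot F (t, 0) • γ.vec := by
  have h := congrArg vec (hF.map_param_mul t v 0 hγ (rot_of_mem hΓ hγ))
  rw [hF.pullVec_center hn hΓ hpos t _ 0 _, hF.pullRot_fibre hn hΓ hpos t 0 (v, 0)]
  exact h

lemma norm_pullVec_sub_le (t : ℝ) {κ : ℝ} (hκ : 0 ≤ κ)
    (hm : m (Circle.exp t) = m (F (param (t, 0))).rot * κ ^ 2) (v w : EuclideanSpace ℂ (Fin n)) :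
    ‖pullVec F (t, (v, 0)) - pullVec F (t, (w, 0))‖ ≤ κ * ‖v - w‖ := by
  have h1 : ∀ v, HasFDerivAt (fun v => pullVec F (t, (v, 0)))
      ((fderiv ℝ (pullVec F) (t, (v, 0))).comp ((ContinuousLinearMap.inr ℝ ℝ (HeisModel n)).comp
        (ContinuousLinearMap.inl ℝ (EuclideanSpace ℂ (Fin n)) ℝ))) v := fun v =>
    (differentiable_pullVec hF.contMDiff (t, (v, 0))).hasFDerivAt.comp
      (f := fun v : EuclideanSpace ℂ (Fin n) => ((t, (v, 0)) : ℝ × HeisModel n)) v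
      (HasFDerivAt.comp (g := fun q : HeisModel n => (t, q))
        (f := fun v : EuclideanSpace ℂ (Fin n) => (v, (0 : ℝ))) v
        (hasFDerivAt_prodMk_right t _) (hasFDerivAt_prodMk_left v (0 : ℝ)))
  refine convex_univ.norm_image_sub_le_of_norm_hasFDerivWithin_le (𝕜 := ℝ)
    (f := fun v => pullVec F (t, (v, 0))) (fun v _ => (h1 v).hasFDerivWithinAt) (fun v _ => ?_)
    (Set.mem_univ w) (Set.mem_univ v)
  refine ContinuousLinearMap.opNorm_le_bound _ hκ fun e => ?_
  have h2 := hF.norm_fderiv_pullVec_fibre hn hΓ hpos (t, (v, 0)) (e, 0)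
  rw [hF.rot_fibre hn hΓ hpos t _ 0, hm, mul_assoc] at h2
  have h3 := mul_left_cancel₀ (hpos _).ne' h2
  rw [← mul_pow] at h3
  exact ((sq_eq_sq₀ (norm_nonneg _) (by positivity)).1 h3).le

/-- On each fibre `F` is a similarity of `ℂⁿ` commuting with the lattice up to rotation; hence its
ratio is at least one. -/
lemma m_rot_le (t : ℝ) : m (F (param (t, 0))).rot ≤ m (Circle.exp t) := by
  obtain ⟨γ, hγ, hne⟩ := exists_mem_vec_ne_zero hΓ hn
  have h0 := hpos (F (param (t, 0))).rot
  set κ := √(m (Circle.exp t) / m (F (param (t, 0))).rot) with hκ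
  have h1 : m (Circle.exp t) = m (F (param (t, 0))).rot * κ ^ 2 := by
    rw [hκ, Real.sq_sqrt (div_nonneg (hpos _).le h0.le), mul_div_cancel₀ _ h0.ne']
  have h2 := hF.norm_pullVec_sub_le hn hΓ hpos t (Real.sqrt_nonneg _) h1
    (0 + (Circle.exp t : ℂ) • γ.vec) 0
  rw [hF.pullVec_add hn hΓ hpos t 0 hγ] at h2
  simp only [add_sub_cancel_left, zero_add, sub_zero, norm_smul, pullRot, Circle.norm_coe,
    one_mul] at h2
  have h3 : 1 ≤ κ := by
    have : 0 < ‖γ.vec‖ := norm_pos_iff.2 hne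
    exact le_of_mul_le_mul_right (by simpa using h2) this
  rw [h1]
  exact le_mul_of_one_le_right h0.le (one_le_pow₀ h3)

lemma angSpeed_eq (t : ℝ) (q : HeisModel n) (e : ℝ) :
    angSpeed F (t, q) (e, 0) = angSpeed F (t, 0) (e, 0) := by
  unfold angSpeed
  rw [fderiv_eq_of_fibre_const (hF.pullRot_fibre hn hΓ hpos) t q 0,
    hF.pullRot_fibre hn hΓ hpos t q 0]

/-- The image of `Z` is `Z`: it is a multiple of `Z` by a factor constant on the fibres, and
equivariance under the central elements of `Γ` fixes that factor. -/
lemma fderiv_pullHt_center (p : ℝ × HeisModel n) : fderiv ℝ (pullHt F) p (0, (0, 1)) = 1 := by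
  obtain ⟨t, v, c⟩ := p
  obtain ⟨c₀, hc0, hcΓ⟩ := exists_central_mem hΓ hn
  have h1 : ∀ x : ℝ, fderiv ℝ (pullHt F) ((t, (v, c)) + x • ((0, (0, 1)) : ℝ × HeisModel n))
      (0, (0, 1)) = fderiv ℝ (pullHt F) (t, (v, c)) (0, (0, 1)) := by
    intro x
    have h2 := hF.angSpeed_mul_contact hpos (exists_central_mem hΓ hn)
    have h3 := h2 ((t, (v, c)) + x • ((0, (0, 1)) : ℝ × HeisModel n))
    have h4 := h2 (t, (v, c))
    have h5 : ((t, (v, c)) + x • ((0, (0, 1)) : ℝ × HeisModel n)) = (t, (v, c + x)) := by simp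
    rw [h5] at h3 ⊢
    have h6 := hF.angSpeed_eq hn hΓ hpos t
    have h7 := fun q => hF.rot_fibre hn hΓ hpos t q 0
    erw [h6, h7] at h3
    erw [h6, h7] at h4
    rw [← mul_assoc] at h3 h4
    have h8 : m (F (param (t, 0))).rot * angSpeed F (t, 0) (1, 0) ≠ 0 := by
      intro h0
      rw [h0, zero_mul] at h3
      exact (hpos _).ne h3
    exact mul_left_cancel₀ h8 (h3.trans h4.symm)
  have h2 := eq_add_smul_of_fderiv_line_eq (differentiable_pullHt hF.contMDiff) h1 c₀
  have h3 := congrArg ht (hF.map_param_mul t v c hcΓ rfl)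
  simp only [vec_mk, smul_zero, add_zero, ht_mk, inner_zero_right, Complex.zero_im, zero_div,
    ht_mul] at h3
  have h4 : pullHt F (t, (v, c + c₀)) = pullHt F (t, (v, c)) + c₀ := h3
  have h5 : ((t, (v, c)) + c₀ • ((0, (0, 1)) : ℝ × HeisModel n)) = (t, (v, c + c₀)) := by simp
  rw [h5, h4] at h2
  have h6 : c₀ * 1 = c₀ * fderiv ℝ (pullHt F) (t, (v, c)) (0, (0, 1)) := by
    simpa using h2
  exact (mul_left_cancel₀ hc0.ne' h6).symm

lemma m_mul_angSpeed (p : ℝ × HeisModel n) :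
    m (F (param p)).rot * angSpeed F p (1, 0) = m (Circle.exp p.1) := by
  have h := hF.angSpeed_mul_contact hpos (exists_central_mem hΓ hn) p
  rwa [hF.fderiv_pullHt_center hn hΓ hpos, mul_one] at h

/-- The circle map induced by `F` has speed `m / (m ∘ F) ≥ 1` and degree one, hence speed one. -/
lemma angSpeed_one (p : ℝ × HeisModel n) : angSpeed F p (1, 0) = 1 := by
  refine hF.angSpeed_eq_of_periodic p (1, 0) Real.two_pi_pos (fun x => ?_) ?_ (Or.inl fun x => ?_)
  · have : param (p + (x + 2 * Real.pi) • ((1, 0) : ℝ × HeisModel n)) =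
        param (p + x • ((1, 0) : ℝ × HeisModel n)) := by
      ext1 <;> simp [param, ← add_assoc]
    simp only [pullRot, this]
  · rw [Complex.exp_neg]
    simp [Complex.exp_two_pi_mul_I]
  · set p' := p + x • ((1, 0) : ℝ × HeisModel n)
    have h1 := hF.m_mul_angSpeed hn hΓ hpos p'
    have h2 : m (F (param p')).rot ≤ m (Circle.exp p'.1) := by
      have := hF.m_rot_le hn hΓ hpos p'.1
      rwa [hF.rot_fibre hn hΓ hpos p'.1 0 p'.2] at this
    have h3 := hpos (F (param p')).rot
    rw [← h1] at h2
    change 1 ≤ angSpeed F p' (1, 0)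
    nlinarith

lemma pullRot_eq_mul (p : ℝ × HeisModel n) :
    pullRot F p = pullRot F 0 * Complex.exp (p.1 * Complex.I) := by
  have h := hF.hasDerivAt_relRot 0 (1, 0)
  simp only [hF.angSpeed_one hn hΓ hpos, sub_self, Complex.ofReal_zero, zero_mul] at h
  have h1 := is_const_of_deriv_eq_zero (fun x => (h x).differentiableAt) (fun x => (h x).deriv) p.1 0
  have h2 : pullRot F p = pullRot F (0 + p.1 • ((1, 0) : ℝ × HeisModel n)) := by
    rw [show (0 + p.1 • ((1, 0) : ℝ × HeisModel n)) = (p.1, 0) by simp]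
    exact hF.pullRot_fibre hn hΓ hpos p.1 p.2 0
  rw [h2]
  simp only [Complex.exp_neg] at h1
  simp at h1 ⊢
  field_simp [Complex.exp_ne_zero] at h1
  rw [h1, mul_comm]

variable (hsym : ∀ w : Circle, (∀ z, m (w * z) = m z) → w = 1)
include hsym

/-- The circle map induced by `F` is a rotation that preserves `m`, hence the identity. -/
lemma rot_map (s : Warped n) : (F s).rot = s.rot := by
  have h0 : ∀ p, (F (param p)).rot = (F (param 0)).rot * Circle.exp p.1 := fun p =>
    Circle.ext (by simpa [pullRot] using hF.pullRot_eq_mul hn hΓ hpos p)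
  have h1 : (F (param 0)).rot = 1 := by
    refine hsym _ fun z => ?_
    obtain ⟨t, rfl⟩ := Circle.exp_surjective z
    have h2 := hF.m_mul_angSpeed hn hΓ hpos (t, 0)
    rwa [hF.angSpeed_one hn hΓ hpos, mul_one, h0] at h2
  obtain ⟨p, rfl⟩ := param_surjective s
  rw [h0, h1, one_mul]; rfl

lemma pullRot_eq (p : ℝ × HeisModel n) : pullRot F p = (Circle.exp p.1 : ℂ) := by
  rw [pullRot, hF.rot_map hn hΓ hpos hsym]; rfl

/-- On each fibre `F` acts on `ℂⁿ` by a translation. -/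
lemma pullVec_eq (t : ℝ) (v : EuclideanSpace ℂ (Fin n)) (c : ℝ) :
    pullVec F (t, (v, c)) = v + pullVec F (t, 0) := by
  let _ : InnerProductSpace ℝ (EuclideanSpace ℂ (Fin n)) := InnerProductSpace.rclikeToReal ℂ _
  have hin : ∀ x y : EuclideanSpace ℂ (Fin n), inner ℝ x y = (inner ℂ x y : ℂ).re := fun _ _ => rfl
  set A : EuclideanSpace ℂ (Fin n) → EuclideanSpace ℂ (Fin n) := fun v => pullVec F (t, (v, 0))
    with hAdef
  have hA : ∀ v w, ‖A v - A w‖ ≤ ‖v - w‖ := by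
    intro v w
    have h := hF.norm_pullVec_sub_le hn hΓ hpos t zero_le_one
      (by rw [hF.rot_map hn hΓ hpos hsym, one_pow, mul_one]; rfl) v w
    rwa [one_mul] at h
  have hγ : ∀ γ ∈ Γ, ∀ v, A (v + (Circle.exp t : ℂ) • γ.vec) = A v + (Circle.exp t : ℂ) • γ.vec := by
    intro γ hγ v
    have h := hF.pullVec_add hn hΓ hpos t v hγ
    rwa [hF.pullRot_eq hn hΓ hpos hsym] at h
  have h1 : ∀ γ ∈ Γ, inner ℝ (v - 0) ((Circle.exp t : ℂ) • γ.vec) ≤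
      inner ℝ (A v - A 0) ((Circle.exp t : ℂ) • γ.vec) := fun γ h =>
    inner_sub_le_of_contraction_of_equivariant hA (hγ γ h) v 0
  have h2 : starRingEnd ℂ (Circle.exp t : ℂ) • ((A v - A 0) - v) = 0 := by
    have h3 : ∀ γ ∈ Γ,
        0 ≤ (inner ℂ (starRingEnd ℂ (Circle.exp t : ℂ) • ((A v - A 0) - v)) γ.vec : ℂ).re := by
      intro γ hγ
      have h4 := h1 γ hγ
      rw [hin, hin, inner_smul_right, inner_smul_right] at h4
      rw [inner_smul_left, Complex.conj_conj, inner_sub_left, mul_sub, Complex.sub_re]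
      rw [sub_zero] at h4
      linarith
    refine eq_zero_of_re_inner_vec hΓ fun γ hγ => le_antisymm ?_ (h3 γ hγ)
    have h5 := h3 γ⁻¹ (Γ.inv_mem hγ)
    rw [vec_inv, rot_of_mem hΓ hγ, inv_one, Circle.coe_one, one_smul, inner_neg_right,
      Complex.neg_re] at h5
    linarith
  have h3 : (A v - A 0) - v = 0 :=
    (smul_eq_zero.1 h2).resolve_left ((map_ne_zero _).2 (Circle.coe_ne_zero _))
  rw [hF.pullVec_center hn hΓ hpos t v c 0]
  exact sub_eq_zero.1 (by rw [← h3]; simp only [hAdef]; change _ = _ - pullVec F (t, 0) - v; abel)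

/-- In the `t`-direction the `ℂⁿ` component of `F` varies only by the translation part. -/
lemma fderiv_pullVec (p e : ℝ × HeisModel n) :
    fderiv ℝ (pullVec F) p e = e.2.1 + fderiv ℝ (pullVec F) (p.1, 0) (e.1, 0) := by
  set f : ℝ × HeisModel n → EuclideanSpace ℂ (Fin n) := fun p => pullVec F p - p.2.1 with hf
  have hff : ∀ t q q', f (t, q) = f (t, q') := by
    rintro t ⟨v, c⟩ ⟨v', c'⟩
    simp only [hf]
    rw [hF.pullVec_eq hn hΓ hpos hsym t v c, hF.pullVec_eq hn hΓ hpos hsym t v' c']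
    abel
  have hl : ∀ p e, fderiv ℝ f p e = fderiv ℝ (pullVec F) p e - e.2.1 := by
    intro p e
    have h1 := (differentiable_pullVec hF.contMDiff p).hasFDerivAt.sub
      ((ContinuousLinearMap.fst ℝ _ _ ∘L ContinuousLinearMap.snd ℝ ℝ (HeisModel n)).hasFDerivAt
        (x := p))
    have h2 : HasFDerivAt f _ p := h1
    rw [h2.fderiv]; rfl
  have h3 : fderiv ℝ f p (0, e.2) = 0 := by
    have h4 : HasFDerivAt (fun q : HeisModel n => f (p.1, q))
        ((fderiv ℝ f p).comp (ContinuousLinearMap.inr ℝ ℝ (HeisModel n))) p.2 := by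
      have hd : DifferentiableAt ℝ f p :=
        (differentiable_pullVec hF.contMDiff p).sub (by fun_prop)
      exact hd.hasFDerivAt.comp (f := fun q : HeisModel n => (p.1, q)) p.2
        (hasFDerivAt_prodMk_right p.1 p.2)
    have h5 : (fun q : HeisModel n => f (p.1, q)) = fun _ => f (p.1, 0) := funext fun q => hff _ _ _
    rw [h5] at h4
    exact DFunLike.congr_fun (h4.unique (hasFDerivAt_const _ _)) e.2
  have h4 : e = (e.1, 0) + (0, e.2) := by simp
  have h5 : fderiv ℝ f p e = fderiv ℝ f (p.1, 0) (e.1, 0) := by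
    conv_lhs => rw [h4]
    rw [map_add, h3, add_zero, ← fderiv_eq_of_fibre_const hff p.1 p.2 0]
  rw [hl, hl] at h5
  rw [← sub_eq_iff_eq_add', h5]
  simp

/-- The isometry equation for a vector tangent to the fibre and `W` determines the central
component on the fibres in terms of the translation part and its velocity. -/
lemma fderiv_pullHt_fibre (p : ℝ × HeisModel n) (e : HeisModel n) :
    fderiv ℝ (pullHt F) p (0, e) = e.2 + (inner ℂ (pullVec F (p.1, 0)) e.1 : ℂ).im / 2 -
      (inner ℂ (fderiv ℝ (pullVec F) (p.1, 0) (1, 0)) e.1 : ℂ).re := by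
  have h1 := hF.metric_eq p (0, (e.1, 0)) (1, 0)
  rw [hF.rot_map hn hΓ hpos hsym] at h1
  have h2 := mul_left_cancel₀ (hpos _).ne' h1
  rw [hF.angSpeed_fibre hpos (exists_central_mem hΓ hn), hF.angSpeed_one hn hΓ hpos,
    hF.fderiv_pullVec hn hΓ hpos hsym p (0, (e.1, 0)), hF.fderiv_pullVec hn hΓ hpos hsym p (1, 0),
    contact, contact,
    hF.fderiv_pullVec hn hΓ hpos hsym p (0, (e.1, 0))] at h2
  have h3 : pullVec F p = p.2.1 + pullVec F (p.1, 0) := hF.pullVec_eq hn hΓ hpos hsym p.1 p.2.1 p.2.2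
  have h6 : ((0, e) : ℝ × HeisModel n) = (0, (e.1, 0)) + e.2 • (0, (0, 1)) := by simp
  have h5 : (inner ℂ e.1 (fderiv ℝ (pullVec F) (p.1, 0) (1, 0)) : ℂ).re =
      (inner ℂ (fderiv ℝ (pullVec F) (p.1, 0) (1, 0)) e.1 : ℂ).re := by
    rw [← inner_conj_symm, Complex.conj_re]
  have h7 : ((0, 0) : ℝ × HeisModel n) = 0 := rfl
  rw [h6, map_add, map_smul, hF.fderiv_pullHt_center hn hΓ hpos]
  simp only [h3, inner_add_left, Complex.add_im, h7, map_zero, add_zero, Prod.fst_zero,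
    Prod.snd_zero, zero_add, inner_zero_right, Complex.zero_im, zero_mul, zero_div, sub_zero,
    one_mul, h5, zero_sub, Complex.zero_re] at h2
  simp only [smul_eq_mul, mul_one]
  linarith

/-- The translation part has velocity zero: commuting with `γ ∈ Γ` forces the velocity to be
orthogonal to the rotated `ℂⁿ` component of `γ`, and these span. -/
lemma fderiv_pullVec_horizontal (t : ℝ) : fderiv ℝ (pullVec F) (t, 0) (1, 0) = 0 := by
  set a' := fderiv ℝ (pullVec F) (t, 0) (1, 0) with ha'
  have h2 : starRingEnd ℂ (Circle.exp t : ℂ) • a' = 0 := by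
    refine eq_zero_of_re_inner_vec hΓ fun γ hγ => ?_
    set x := (Circle.exp t : ℂ) • γ.vec with hx
    have h1 := eq_add_smul_of_fderiv_line_eq (differentiable_pullHt hF.contMDiff)
      (p := ((t, 0) : ℝ × HeisModel n)) (e := (0, (x, γ.ht)))
      (a := γ.ht + (inner ℂ (pullVec F (t, 0)) x : ℂ).im / 2 - (inner ℂ a' x : ℂ).re) (fun r => by
        rw [hF.fderiv_pullHt_fibre hn hΓ hpos hsym, ha']
        simp) 1
    have h3 := congrArg ht (hF.map_param_mul t 0 0 hγ (rot_of_mem hΓ hγ))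
    have h4 : pullHt F (t, (x, γ.ht)) = pullHt F (t, 0) + γ.ht +
        (inner ℂ (pullVec F (t, 0)) x : ℂ).im / 2 := by
      rw [ht_mul, hF.rot_map hn hΓ hpos hsym] at h3
      simp only [zero_add, inner_zero_left, Complex.zero_im, zero_div, add_zero] at h3
      exact h3
    have h5 : (inner ℂ a' x : ℂ).re = 0 := by
      simp only [one_smul, Prod.mk_add_mk, add_zero, zero_add] at h1
      rw [h4] at h1
      linarith
    rw [inner_smul_left, Complex.conj_conj, ← inner_smul_right]
    exact h5
  exact (smul_eq_zero.1 h2).resolve_left ((map_ne_zero _).2 (Circle.coe_ne_zero _))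

lemma pullVec_eq_const (p : ℝ × HeisModel n) : pullVec F p = p.2.1 + pullVec F 0 := by
  have h1 := eq_add_smul_of_fderiv_line_eq (differentiable_pullVec hF.contMDiff)
    (p := (0 : ℝ × HeisModel n)) (e := p) (a := p.2.1) (fun x => by
      rw [hF.fderiv_pullVec hn hΓ hpos hsym]
      have : ((p.1, 0) : ℝ × HeisModel n) = p.1 • (1, 0) := by simp
      rw [this, map_smul, hF.fderiv_pullVec_horizontal hn hΓ hpos hsym]
      simp) 1
  rw [one_smul, one_smul, zero_add] at h1
  rw [h1, add_comm]

lemma pullHt_eq (p : ℝ × HeisModel n) :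
    pullHt F p = pullHt F 0 + p.2.2 + (inner ℂ (pullVec F 0) p.2.1 : ℂ).im / 2 := by
  have h0 : ∀ q : ℝ × HeisModel n, fderiv ℝ (pullHt F) q (1, 0) = 0 := by
    intro q
    have h1 := hF.metric_self q (1, 0)
    rw [hF.fderiv_pullVec hn hΓ hpos hsym q (1, 0), hF.angSpeed_one hn hΓ hpos, contact,
      hF.fderiv_pullVec hn hΓ hpos hsym q (1, 0),
      hF.fderiv_pullVec_horizontal hn hΓ hpos hsym] at h1
    simpa [(hpos _).ne'] using h1
  have h1 := eq_add_smul_of_fderiv_line_eq (differentiable_pullHt hF.contMDiff)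
    (p := (0 : ℝ × HeisModel n)) (e := p)
    (a := p.2.2 + (inner ℂ (pullVec F 0) p.2.1 : ℂ).im / 2) (fun x => by
      have h2 : p = p.1 • (1, 0) + (0, p.2) := by simp
      conv_lhs => rw [h2]
      rw [map_add, map_smul, h0, hF.fderiv_pullHt_fibre hn hΓ hpos hsym,
        hF.fderiv_pullVec_horizontal hn hΓ hpos hsym, hF.pullVec_eq_const hn hΓ hpos hsym]
      simp) 1
  rw [one_smul, one_smul, zero_add] at h1
  rw [h1, add_assoc]

/-- A near isometry is the left translation by an element of the Heisenberg group. -/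
theorem eq_left_translation (s : Warped n) : F s = F 1 * s := by
  obtain ⟨p, rfl⟩ := param_surjective s
  have h1 : (1 : Warped n) = param 0 := by ext1 <;> simp [param]
  have hr := hF.rot_map hn hΓ hpos hsym
  ext1
  · rw [rot_mul, hr, hr, rot_one, one_mul]
  · rw [vec_mul, hr, h1]
    refine (hF.pullVec_eq_const hn hΓ hpos hsym p).trans ?_
    simp [param, pullVec, add_comm]
  · rw [ht_mul, hr, h1]
    refine (hF.pullHt_eq hn hΓ hpos hsym p).trans ?_
    simp [param, pullVec, pullHt]

end IsNearIsometry

/-! ### The action of the Heisenberg group on the quotient -/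

instance : ConnectedSpace (Warped n) :=
  haveI : ConnectedSpace Circle := Circle.exp_surjective.connectedSpace Circle.exp.continuous
  inferInstanceAs (ConnectedSpace (Circle × HeisModel n))

instance : LocallyCompactSpace (Warped n) :=
  inferInstanceAs (LocallyCompactSpace (Circle × HeisModel n))

section Lift
variable (Γ : Subgroup (Warped n)) [DiscreteTopology Γ]
  {f : Warped n ⧸ Γ → Warped n ⧸ Γ} {F : Warped n → Warped n}

lemma contMDiff_of_lift (hF : ContMDiff (modelS n) (modelS n) ∞ F)
    (h : ∀ s : Warped n, f s = F s) : ContMDiff (modelS n) (modelS n) ∞ f := by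
  intro q
  obtain ⟨s, rfl⟩ := QuotientGroup.mk_surjective q
  set hl := isLocalHomeomorph_mk Γ
  set L := hl.localInverseAt s
  have hs : (s : Warped n ⧸ Γ) ∈ L.source := hl.apply_self_mem_localInverseAt_source
  have h1 : ContMDiffAt (modelS n) (modelS n) ∞ L (s : Warped n ⧸ Γ) :=
    (contMDiffOn_localInverseAt Γ s).contMDiffAt (L.open_source.mem_nhds hs)
  refine (((contMDiff_mk Γ).comp hF).contMDiffAt.comp _ h1).congr_of_eventuallyEq ?_
  filter_upwards [L.open_source.mem_nhds hs] with x hx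
  have h2 : ((L x : Warped n) : Warped n ⧸ Γ) = x := hl.apply_localInverseAt_of_mem hx
  conv_lhs => rw [← h2, h]
  rfl

/-- The differential of `f` preserves the metric of `S / Γ` where that of its lift `F` preserves
`m θ`. -/
lemma quotientMetric_map (hΓ : Γ ≤ heisenberg n) (m : Circle → ℝ)
    (hF : ContMDiff (modelS n) (modelS n) ∞ F) (hf : ContMDiff (modelS n) (modelS n) ∞ f)
    (h : ∀ s : Warped n, f s = F s) (s : Warped n) (u v : TangentSpace (modelS n) s) :
    quotientMetric Γ m (f s)
      (mfderiv (modelS n) (modelS n) f (s : Warped n ⧸ Γ)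
        (mfderiv (modelS n) (modelS n) (QuotientGroup.mk : Warped n → Warped n ⧸ Γ) s u))
      (mfderiv (modelS n) (modelS n) f (s : Warped n ⧸ Γ)
        (mfderiv (modelS n) (modelS n) (QuotientGroup.mk : Warped n → Warped n ⧸ Γ) s v)) =
    conformalMetric m (F s) (mfderiv (modelS n) (modelS n) F s u)
      (mfderiv (modelS n) (modelS n) F s v) := by
  have hmk : MDifferentiable (modelS n) (modelS n) (QuotientGroup.mk : Warped n → Warped n ⧸ Γ) :=
    (contMDiff_mk Γ).mdifferentiable (by simp)
  have h1 := mfderiv_comp (I := modelS n) (I' := modelS n) (I'' := modelS n) s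
    (hf.mdifferentiable (by simp) (s : Warped n ⧸ Γ)) (hmk s)
  have h2 := mfderiv_comp (I := modelS n) (I' := modelS n) (I'' := modelS n) s
    (hmk (F s)) (hF.mdifferentiable (by simp) s)
  have h3 : f ∘ (QuotientGroup.mk : Warped n → Warped n ⧸ Γ) = QuotientGroup.mk ∘ F := funext h
  rw [h3, h2] at h1
  have h4 : ∀ (x y : Warped n ⧸ Γ), x = y → ∀ a b : ModelVS n,
      quotientMetric Γ m x a b = quotientMetric Γ m y a b := by
    rintro x _ rfl a b; rfl
  rw [← quotientMetric_mk Γ hΓ]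
  refine (h4 _ _ (h s) _ _).trans ?_
  congr 1
  · exact (DFunLike.congr_fun h1 u).symm
  · exact (DFunLike.congr_fun h1 v).symm

lemma exists_mfderiv_mk_eq (s : Warped n) (a : TangentSpace (modelS n) (s : Warped n ⧸ Γ)) :
    ∃ u : TangentSpace (modelS n) s,
      mfderiv (modelS n) (modelS n) (QuotientGroup.mk : Warped n → Warped n ⧸ Γ) s u = a := by
  rw [← (isLocalDiffeomorph_mk Γ).mfderivToContinuousLinearEquiv_coe (by simp) s]
  exact ContinuousLinearEquiv.surjective _ a

/-- The isometries of `S / Γ` given by the elements of `H`. -/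
def heisenbergAction (m : Circle → ℝ) (hΓ : Γ ≤ heisenberg n) : heisenberg n →* isomGroup Γ m where
  toFun h := ⟨Homeomorph.smul (h : Warped n),
    contMDiff_of_lift Γ (contMDiff_mul_left (a := (h : Warped n))) fun _ => rfl,
    contMDiff_of_lift Γ (contMDiff_mul_left (a := (h : Warped n)⁻¹)) fun _ => rfl, by
      intro x a b
      obtain ⟨s, rfl⟩ := QuotientGroup.mk_surjective x
      obtain ⟨u, rfl⟩ := exists_mfderiv_mk_eq Γ s a
      obtain ⟨v, rfl⟩ := exists_mfderiv_mk_eq Γ s b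
      have hF : ContMDiff (modelS n) (modelS n) ∞ (fun t : Warped n => (h : Warped n) * t) :=
        contMDiff_mul_left
      refine (quotientMetric_map Γ hΓ m hF (contMDiff_of_lift Γ hF fun _ => rfl)
        (fun _ => rfl) s u v).trans ?_
      rw [quotientMetric_mk Γ hΓ]
      have hh : (h : Warped n).rot = 1 := h.2
      simp only [conformalMetric, theta_mul_left, rot_mul, hh, one_mul]⟩
  map_one' := Subtype.ext (Homeomorph.ext fun x => one_smul (Warped n) x)
  map_mul' g h := Subtype.ext (Homeomorph.ext fun x => mul_smul (g : Warped n) (h : Warped n) x)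

end Lift

/-! ### Isometries close to the identity -/

section Near
variable (Γ : Subgroup (Warped n)) [DiscreteTopology Γ] [CompactSpace (Warped n ⧸ Γ)]

/-- Two distinct elements of `S` close to the identity move every point of `S / Γ` to different
points: the injectivity radius of a compact quotient is positive. -/
lemma eventually_smul_injective : ∀ᶠ p : Warped n × Warped n in 𝓝 (1, 1),
    ∀ x : Warped n ⧸ Γ, p.1 • x = p.2 • x → p.1 = p.2 := by
  obtain ⟨O, hO, hO1⟩ := isOpen_induced_iff.1 (isOpen_discrete ({1} : Set Γ))
  have h1O : (1 : Warped n) ∈ O := by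
    have : (1 : Γ) ∈ Subtype.val ⁻¹' O := by rw [hO1]; rfl
    exact this
  have key := isCompact_univ.eventually_forall_of_forall_eventually
    (X := Warped n × Warped n) (Y := Warped n ⧸ Γ) (x₀ := (1, 1)) (K := Set.univ)
    (P := fun p x => p.1 • x = p.2 • x → p.1 = p.2) ?_
  · simpa using key
  intro x _
  obtain ⟨s, rfl⟩ := QuotientGroup.mk_surjective x
  rw [nhds_prod_eq, QuotientGroup.nhds_eq, ← Filter.map_id (f := 𝓝 ((1, 1) : Warped n × Warped n)),
    Filter.prod_map_map_eq, ← nhds_prod_eq, Filter.eventually_map]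
  have hc : Continuous fun z : (Warped n × Warped n) × Warped n =>
      z.2⁻¹ * z.1.1⁻¹ * z.1.2 * z.2 := by fun_prop
  have hev : ∀ᶠ z : (Warped n × Warped n) × Warped n in 𝓝 ((1, 1), s),
      z.2⁻¹ * z.1.1⁻¹ * z.1.2 * z.2 ∈ O :=
    hc.continuousAt.eventually (hO.mem_nhds (by simpa using h1O))
  filter_upwards [hev] with z hz heq
  have h2 : (z.1.1 * z.2)⁻¹ * (z.1.2 * z.2) ∈ Γ := QuotientGroup.eq.1 heq
  rw [mul_inv_rev, ← mul_assoc] at h2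
  have h3 : (⟨_, h2⟩ : Γ) ∈ Subtype.val ⁻¹' O := hz
  rw [hO1] at h3
  have h4 : z.2⁻¹ * z.1.1⁻¹ * z.1.2 * z.2 = 1 := congrArg Subtype.val h3
  have h5 : z.1.1⁻¹ * z.1.2 = 1 := by
    have : z.1.1⁻¹ * z.1.2 = z.2 * (z.2⁻¹ * z.1.1⁻¹ * z.1.2 * z.2) * z.2⁻¹ := by group
    rw [this, h4]; group
  exact inv_mul_eq_one.1 h5

omit [CompactSpace (Warped n ⧸ Γ)] in
lemma continuous_isomGroup_val (m : Circle → ℝ) :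
    Continuous fun f : isomGroup Γ m => (f.1 : C(Warped n ⧸ Γ, Warped n ⧸ Γ)) :=
  continuous_induced_dom

omit [CompactSpace (Warped n ⧸ Γ)] in
lemma continuous_isomGroup_eval (m : Circle → ℝ) :
    Continuous fun p : isomGroup Γ m × (Warped n ⧸ Γ) => p.1.1 p.2 :=
  ((continuous_isomGroup_val Γ m).comp continuous_fst).eval continuous_snd

instance (m : Circle → ℝ) : SeparatelyContinuousMul (isomGroup Γ m) where
  continuous_const_mul {g} := continuous_induced_rng.2 <|
    (ContinuousMap.continuous_postcomp (g.1 : C(Warped n ⧸ Γ, Warped n ⧸ Γ))).comp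
      (continuous_isomGroup_val Γ m)
  continuous_mul_const {g} := continuous_induced_rng.2 <|
    (ContinuousMap.continuous_precomp (g.1 : C(Warped n ⧸ Γ, Warped n ⧸ Γ))).comp
      (continuous_isomGroup_val Γ m)

/-- An isometry close to the identity in the compact-open topology displaces every point by a
small element of `S`. -/
lemma eventually_exists_displacement (m : Circle → ℝ) {U : Set (Warped n)} (hU : U ∈ 𝓝 1) :
    ∀ᶠ f : isomGroup Γ m in 𝓝 1, ∀ x : Warped n ⧸ Γ, ∃ u ∈ U, f.1 x = u • x := by
  have key := isCompact_univ.eventually_forall_of_forall_eventually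
    (X := isomGroup Γ m) (Y := Warped n ⧸ Γ) (x₀ := 1) (K := Set.univ)
    (P := fun f x => ∃ u ∈ U, f.1 x = u • x) ?_
  · simpa using key
  intro x _
  have h1 : ∀ᶠ z : (Warped n ⧸ Γ) × (Warped n ⧸ Γ) in 𝓝 (x, x), ∃ u ∈ U, z.1 = u • z.2 := by
    obtain ⟨s, rfl⟩ := QuotientGroup.mk_surjective x
    rw [nhds_prod_eq, QuotientGroup.nhds_eq, Filter.prod_map_map_eq, ← nhds_prod_eq,
      Filter.eventually_map]
    have hc : Continuous fun z : Warped n × Warped n => z.1 * z.2⁻¹ := by fun_prop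
    have hev : ∀ᶠ z : Warped n × Warped n in 𝓝 (s, s), z.1 * z.2⁻¹ ∈ U :=
      hc.continuousAt.preimage_mem_nhds (by simpa using hU)
    filter_upwards [hev] with z hz
    refine ⟨_, hz, ?_⟩
    change (z.1 : Warped n ⧸ Γ) = ((z.1 * z.2⁻¹ * z.2 : Warped n) : Warped n ⧸ Γ)
    rw [inv_mul_cancel_right]
  have h2 : Continuous fun p : isomGroup Γ m × (Warped n ⧸ Γ) => (p.1.1 p.2, p.2) :=
    (continuous_isomGroup_eval Γ m).prodMk continuous_snd
  exact (h2.tendsto (1, x)).eventually h1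

omit [CompactSpace (Warped n ⧸ Γ)] in
/-- An isometry of `S / Γ` that displaces every point by a small element of `S` lifts to a near
isometry of `S` with the same displacement. -/
lemma exists_isNearIsometry {m : Circle → ℝ} (hΓ : Γ ≤ heisenberg n) {U : Set (Warped n)}
    (hU : IsOpen U) (hre : ∀ u ∈ U, 0 < ((u.rot : Circle) : ℂ).re)
    (hinj : ∀ a ∈ U, ∀ b ∈ U, ∀ x : Warped n ⧸ Γ, a • x = b • x → a = b) (f : isomGroup Γ m)
    (hf : ∀ x : Warped n ⧸ Γ, ∃ u ∈ U, f.1 x = u • x) :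
    ∃ F : Warped n → Warped n, IsNearIsometry Γ m F ∧ F 1 ∈ U ∧ ∀ s : Warped n, f.1 s = F s := by
  choose u huU hu using hf
  set F : Warped n → Warped n := fun s => u s * s with hFdef
  have hFf : ∀ s : Warped n, f.1 s = F s := fun s => hu s
  have hsmooth : ContMDiff (modelS n) (modelS n) ∞ F := by
    intro s
    -- near `s`, by uniqueness of small displacements, `F` is `f` followed by a local inverse of
    -- the covering
    set hl := isLocalHomeomorph_mk Γ
    set L := hl.localInverseAt (F s)
    have hs : f.1 s ∈ L.source := by
      rw [hFf]; exact hl.apply_self_mem_localInverseAt_source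
    have h1 : ContMDiffAt (modelS n) (modelS n) ∞ L (f.1 s) :=
      (contMDiffOn_localInverseAt Γ (F s)).contMDiffAt (L.open_source.mem_nhds hs)
    have h2 : ContMDiff (modelS n) (modelS n) ∞ (fun t : Warped n => f.1 (t : Warped n ⧸ Γ)) :=
      f.2.1.comp (contMDiff_mk Γ)
    have h3 : ContMDiffAt (modelS n) (modelS n) ∞ (fun t : Warped n => L (f.1 t)) s :=
      ContMDiffAt.comp (g := L) (f := fun t : Warped n => f.1 (t : Warped n ⧸ Γ)) s h1 h2.contMDiffAt
    refine h3.congr_of_eventuallyEq ?_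
    have hLs : L (f.1 s) = F s := by
      rw [hFf]; exact hl.localInverseAt_apply_self
    have e1 : ∀ᶠ t : Warped n in 𝓝 s, L (f.1 t) * t⁻¹ ∈ U := by
      have hc : ContinuousAt (fun t : Warped n => L (f.1 t) * t⁻¹) s :=
        h3.continuousAt.mul continuous_inv.continuousAt
      refine hc.preimage_mem_nhds (hU.mem_nhds ?_)
      rw [hLs, hFdef]
      simpa using huU s
    have e2 : ∀ᶠ t : Warped n in 𝓝 s, f.1 t ∈ L.source :=
      h2.continuous.continuousAt.preimage_mem_nhds (L.open_source.mem_nhds hs)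
    filter_upwards [e1, e2] with t ht1 ht2
    have h4 : ((L (f.1 t) : Warped n) : Warped n ⧸ Γ) = f.1 t := hl.apply_localInverseAt_of_mem ht2
    have h5 : u t = L (f.1 t) * t⁻¹ := by
      refine hinj _ (huU _) _ ht1 (t : Warped n ⧸ Γ) ((hu _).symm.trans ?_)
      exact h4.symm.trans (congrArg (QuotientGroup.mk : Warped n → Warped n ⧸ Γ)
        (inv_mul_cancel_right (L (f.1 t)) t).symm)
    simp only [hFdef, h5, inv_mul_cancel_right]
  refine ⟨F, ⟨hsmooth, fun s γ hγ => ?_, fun s a b => ?_, fun s => ?_⟩, ?_, hFf⟩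
  · simp only [hFdef, QuotientGroup.mk_mul_of_mem s hγ, mul_assoc]
  · rw [← quotientMetric_map Γ hΓ m hsmooth f.2.1 hFf, ← quotientMetric_mk Γ hΓ]
    exact f.2.2.2 _ _ _
  · simpa [hFdef] using hre _ (huU s)
  · simpa [hFdef] using huU ((1 : Warped n) : Warped n ⧸ Γ)

/-- Every isometry close to the identity is the action of an element of `H` close to `1`. -/
lemma eventually_mem_heisenberg (hn : 1 ≤ n) (hΓ : Γ ≤ heisenberg n) {m : Circle → ℝ}
    (hpos : ∀ z, 0 < m z) (hsym : ∀ w : Circle, (∀ z, m (w * z) = m z) → w = 1)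
    {V : Set (Warped n)} (hV : V ∈ 𝓝 1) :
    ∀ᶠ f : isomGroup Γ m in 𝓝 1, ∃ h : heisenberg n, (h : Warped n) ∈ V ∧
      f = heisenbergAction Γ m hΓ h := by
  have h1 := eventually_smul_injective Γ
  rw [nhds_prod_eq] at h1
  obtain ⟨U₁, hU₁, h1⟩ := (Filter.eventually_prod_self_iff
    (r := fun a b : Warped n => ∀ x : Warped n ⧸ Γ, a • x = b • x → a = b)).1 h1
  have h2 : ∀ᶠ s : Warped n in 𝓝 1, 0 < ((s.rot : Circle) : ℂ).re := by
    have hc : Continuous fun s : Warped n => ((s.rot : Circle) : ℂ).re :=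
      Complex.continuous_re.comp (continuous_subtype_val.comp continuous_rot)
    exact hc.continuousAt.eventually (lt_mem_nhds (by simp))
  obtain ⟨U, hUsub, hUo, h1U⟩ := mem_nhds_iff.1 (Filter.inter_mem (Filter.inter_mem hU₁ h2) hV)
  filter_upwards [eventually_exists_displacement Γ m (hUo.mem_nhds h1U)] with f hf
  obtain ⟨F, hF, hF1, hfF⟩ := exists_isNearIsometry Γ hΓ hUo (fun u hu => (hUsub hu).1.2)
    (fun a ha b hb => h1 a (hUsub ha).1.1 b (hUsub hb).1.1) f hf
  refine ⟨⟨F 1, hF.rot_map hn hΓ hpos hsym 1⟩, (hUsub hF1).2, ?_⟩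
  refine Subtype.ext (Homeomorph.ext fun x => ?_)
  obtain ⟨s, rfl⟩ := QuotientGroup.mk_surjective x
  rw [hfF, hF.eq_left_translation hn hΓ hpos hsym]
  rfl

end Near

/-! ### The homomorphism to the isometry group -/

section Kernel
variable (Γ : Subgroup (Warped n))

lemma vec_eq_zero_of_mem_center {h : heisenberg n} (hh : h ∈ Subgroup.center (heisenberg n)) :
    (h : Warped n).vec = 0 := by
  have h1 := Subgroup.mem_center_iff.1 hh ⟨mk 1 (Complex.I • (h : Warped n).vec) 0, rfl⟩
  have h2 := congrArg (fun g : heisenberg n => (g : Warped n).ht) h1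
  have h3 : (h : Warped n).rot = 1 := h.2
  have h4 : (inner ℂ (h : Warped n).vec (h : Warped n).vec : ℂ).re = ‖(h : Warped n).vec‖ ^ 2 :=
    inner_self_eq_norm_sq (𝕜 := ℂ) _
  simp only [Subgroup.coe_mul, ht_mul, ht_mk, rot_mk, vec_mk, h3, Circle.coe_one, one_smul,
    inner_smul_left, inner_smul_right, Complex.conj_I, neg_mul, Complex.neg_im, Complex.I_mul_im,
    h4] at h2
  have h5 : ‖(h : Warped n).vec‖ ^ 2 = 0 := by linarith
  simpa using h5

variable [DiscreteTopology Γ] (m : Circle → ℝ) (hΓ : Γ ≤ heisenberg n)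

/-- If `h` acts trivially, `s ↦ s⁻¹ h s` is a continuous map from the connected group `S` to the
discrete group `Γ`; so it is constant, that is, `h` is central and belongs to `Γ`. -/
lemma ker_heisenbergAction : (heisenbergAction Γ m hΓ).ker = centralPart Γ := by
  ext h
  rw [MonoidHom.mem_ker]
  constructor
  · intro hh
    have h1 : ∀ s : Warped n, s⁻¹ * (h : Warped n) * s ∈ Γ := by
      intro s
      have h2 := congrArg (fun f : isomGroup Γ m => f.1 (s : Warped n ⧸ Γ)) hh
      have h3 : (((h : Warped n) * s : Warped n) : Warped n ⧸ Γ) = s := h2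
      have h4 := QuotientGroup.eq.1 h3.symm
      have h5 : s⁻¹ * (h : Warped n) * s = s⁻¹ * ((h : Warped n) * s) := mul_assoc _ _ _
      rw [h5]
      exact h4
    have hc : Continuous fun s : Warped n => (⟨s⁻¹ * (h : Warped n) * s, h1 s⟩ : Γ) :=
      ((continuous_inv.mul continuous_const).mul continuous_id).subtype_mk _
    have h2 : ∀ s : Warped n, s⁻¹ * (h : Warped n) * s = h := by
      intro s
      have h3 := congrArg Subtype.val (PreconnectedSpace.constant inferInstance hc (x := s) (y := 1))
      refine h3.trans ?_
      change (1 : Warped n)⁻¹ * (h : Warped n) * 1 = h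
      rw [inv_one, one_mul, mul_one]
    refine ⟨Subgroup.mem_center_iff.2 fun g => ?_, ?_⟩
    · refine Subtype.ext ?_
      have h3 := h2 g
      rw [mul_assoc, inv_mul_eq_iff_eq_mul] at h3
      exact h3.symm
    · have h3 := h1 1
      rw [h2] at h3
      exact h3
  · rintro ⟨hc, hmem⟩
    have hv := vec_eq_zero_of_mem_center hc
    have hr : (h : Warped n).rot = 1 := h.2
    refine Subtype.ext (Homeomorph.ext fun x => ?_)
    obtain ⟨s, rfl⟩ := QuotientGroup.mk_surjective x
    have h1 : (h : Warped n) * s = s * h := by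
      ext1
      · rw [rot_mul, rot_mul, mul_comm]
      · simp [hv, hr]
      · simp [hv, add_comm]
    change (((h : Warped n) * s : Warped n) : Warped n ⧸ Γ) = s
    rw [h1]
    exact QuotientGroup.mk_mul_of_mem s hmem

lemma continuous_heisenbergAction [CompactSpace (Warped n ⧸ Γ)] :
    Continuous (heisenbergAction Γ m hΓ) := by
  refine continuous_induced_rng.2 (ContinuousMap.continuous_of_continuous_uncurry _ ?_)
  have : Continuous fun p : heisenberg n × (Warped n ⧸ Γ) => (p.1 : Warped n) • p.2 := by fun_prop
  exact this

end Kernel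

instance : ConnectedSpace (heisenberg n) := by
  have h : Function.Surjective
      (fun q : HeisModel n => (⟨mk 1 q.1 q.2, rfl⟩ : heisenberg n)) := by
    intro g
    refine ⟨((g : Warped n).vec, (g : Warped n).ht), Subtype.ext ?_⟩
    have : (g : Warped n).rot = 1 := g.2
    ext1 <;> simp [this]
  refine h.connectedSpace (Continuous.subtype_mk ?_ _)
  have hc : Continuous fun q : HeisModel n => ((1 : Circle), q) := by fun_prop
  exact hc

end WarpedHeisenberg

end

open WarpedHeisenberg in
theorem mainTheorem6 (n : ℕ) (hn : 1 ≤ n)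
    (Γ : Subgroup (Warped n)) [DiscreteTopology Γ] [CompactSpace (Warped n ⧸ Γ)]
    (hΓ : Γ ≤ heisenberg n)
    (m : Circle → ℝ) (hm : ContMDiff (𝓡 1) 𝓘(ℝ, ℝ) ∞ m) (hpos : ∀ z, 0 < m z)
    (hsym : ∀ w : Circle, (∀ z, m (w * z) = m z) → w = 1) :
    ∃ φ : (heisenberg n ⧸ centralPart Γ) →* isomGroup Γ m,
      (∀ (h : heisenberg n) (x : Warped n ⧸ Γ), (φ h).1 x = (h : Warped n) • x) ∧
      Topology.IsEmbedding φ ∧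
      Set.range φ = connectedComponent (1 : isomGroup Γ m) := by
  set ψ := heisenbergAction Γ m hΓ with hψ
  have hker : ψ.ker = centralPart Γ := ker_heisenbergAction Γ m hΓ
  let φ : (heisenberg n ⧸ centralPart Γ) →* isomGroup Γ m :=
    QuotientGroup.lift (centralPart Γ) ψ (le_of_eq hker.symm)
  have hφ : ∀ h : heisenberg n, φ h = ψ h := fun h => rfl
  have hcont : Continuous φ :=
    (continuous_heisenbergAction Γ m hΓ).quotient_lift _
  have hinj : Function.Injective φ := by
    rw [injective_iff_map_eq_one]
    intro q hq
    obtain ⟨h, rfl⟩ := QuotientGroup.mk_surjective q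
    exact (QuotientGroup.eq_one_iff h).2 (hker ▸ (MonoidHom.mem_ker.2 hq))
  have hnear : ∀ {V : Set (Warped n)}, V ∈ 𝓝 1 → ∀ᶠ f : isomGroup Γ m in 𝓝 1,
      ∃ h : heisenberg n, (h : Warped n) ∈ V ∧ f = ψ h := fun hV =>
    eventually_mem_heisenberg Γ hn hΓ hpos hsym hV
  refine ⟨φ, fun h x => rfl, ⟨Topology.isInducing_iff_nhds.2 fun q => ?_, hinj⟩, ?_⟩
  · -- `φ` is open onto its image at `1` by `hnear`, and at `q` by left translation
    refine le_antisymm ((hcont.tendsto q).le_comap) fun V hV => ?_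
    have h1 : (fun y => q * y) ⁻¹' V ∈ 𝓝 (1 : heisenberg n ⧸ centralPart Γ) :=
      (continuous_const_mul q).continuousAt.preimage_mem_nhds (by simpa using hV)
    have h2 : (fun h : heisenberg n => q * (h : heisenberg n ⧸ centralPart Γ)) ⁻¹' V ∈
        𝓝 (1 : heisenberg n) :=
      QuotientGroup.continuous_mk.continuousAt.preimage_mem_nhds h1
    obtain ⟨V', hV', hsub⟩ := mem_nhds_subtype _ _ _ |>.1 h2
    have h3 : ∀ᶠ f in 𝓝 (φ q), ∃ h : heisenberg n, (h : Warped n) ∈ V' ∧ (φ q)⁻¹ * f = ψ h := by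
      have hc : Filter.Tendsto (fun f => (φ q)⁻¹ * f) (𝓝 (φ q)) (𝓝 1) :=
        (continuous_const_mul (φ q)⁻¹).tendsto' _ _ (inv_mul_cancel _)
      exact hc.eventually (hnear hV')
    refine Filter.mem_comap.2 ⟨_, h3, ?_⟩
    rintro y ⟨h, hhV, hh⟩
    have h4 : φ (q⁻¹ * y) = φ (h : heisenberg n ⧸ centralPart Γ) := by
      rw [map_mul, map_inv, hh, hφ]
    have h5 : y = q * (h : heisenberg n ⧸ centralPart Γ) := by
      rw [← hinj h4, mul_inv_cancel_left]
    rw [h5]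
    exact hsub hhV
  · have hopen : IsOpen (φ.range : Set (isomGroup Γ m)) := by
      refine Subgroup.isOpen_of_mem_nhds _ (g := 1) ?_
      filter_upwards [hnear Filter.univ_mem] with f hf
      obtain ⟨h, -, rfl⟩ := hf
      exact ⟨h, hφ h⟩
    have hclopen : IsClopen (Set.range φ) :=
      ⟨Subgroup.isClosed_of_isOpen φ.range hopen, hopen⟩
    refine Set.Subset.antisymm ?_ (hclopen.connectedComponent_subset ⟨1, map_one φ⟩)
    have hrange : Set.range φ = Set.range ψ :=
      (QuotientGroup.mk_surjective.range_comp φ).symm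
    rw [hrange]
    exact (isPreconnected_range (continuous_heisenbergAction Γ m hΓ)).subset_connectedComponent ⟨1, map_one φ⟩
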